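/- Let $d\ge 1$ and let $\phi\in C_0^\infty(\mathbb R)$ be real-valued, supported in the open interval $(0,1)$, not identically zero, with $|\phi(t)|<1$ for all $t$; let $b(t)=\phi(t-\lfloor t\rfloor)$ be its $1$-periodisation. Let $(\tau_k)_{k\ge1}$, $(\delta_k)_{k\ge1}$ be real sequences and $(n_k)_{k\ge1}$ a sequence of positive integers with $\tau_1\ge 0$, $\delta_k>0$, $\tau_{k+1}>\tau_k+\delta_k$ and $\tau_k\to\infty$ (call these admissible), put $I_k=[\tau_k,\tau_k+\delta_k]$, and define $$a(t)=1+b\Big(\frac{n_k}{\delta_k}(t-\tau_k)\Big)\ \text{ for } t\in I_k,\ k\ge 1,\qquad a(t)=1\ \text{ otherwise.}$$ Consider the Cauchy problem $$u_{tt}-a(t)^2\Delta u=0\quad (t\ge0,\ x\in\mathbb R^d),\qquad u(0,\cdot)=u_0,\quad u_t(0,\cdot)=u_1,$$ with data $u_0,u_1\in\mathscr S(\mathbb R^d)$ (complex-valued) and solutions that are twice differentiable in $t\in[0,\infty)$ with values in $\mathscr S(\mathbb R^d)$, and let $\mathbb E(u;t)=\frac12\int_{\mathbb R^d}(|\nabla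 u|^2+|u_t|^2)\,dx$. (1) The number $c=\sup_{s\in\mathbb R}\frac{|b'(s)|}{1+b(s)}$ is finite and positive, and there is a constant $\kappa>0$, not depending on the sequences or on $k$, such that for all admissible $(\tau_k),(\delta_k),(n_k)$ there are data $u_{0,k},u_{1,k}\in\mathscr S(\mathbb R^d)$, $k\ge1$, with $\mathbb E(u_k;0)=1$, for which a solution $u_k$ exists and every solution $u_k$ satisfies $\mathbb E(u_k;\tau_k+\delta_k)>0$ and $$\log \mathbb E(u_k;\tau_k+\delta_k)\ \ge\ 2\kappa\, n_k-2c\sum_{\ell=1}^{k-1}n_\ell .$$ (2) For every $q>0$ there is $\sigma_0>1$ such that for every $\sigma\ge\sigma_0$ the sequences $\tau_k=\sigma^k$, $\delta_k=\sigma^{k-1}$, $n_k=\lceil\sigma^{qk}\rceil$ are admissible, and the corresponding coefficient $a$ is smooth, satisfies $m\le a(t)<2$ for all $t$ with some $m>0$, satisfies $$|a^{(\ell)}(t)|\le C_\ell\,(1+t)^{-(1-q)\ell}\qquad (t\ge0,\ \ell=0,1,2,\dots)$$ with some constants $C_\ell$, and admits no uniform energy bound: there is no constant $C$ such that $\mathbb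 E(u;t)\le C\,\mathbb E(u;0)$ for all $t\ge0$ and all solutions $u$ with data in $\mathscr S(\mathbb R^d)$. -/

import Mathlib

open Set Filter Topology
open scoped ContDiff SchwartzMap LineDeriv Laplacian

noncomputable section

/-- The 1-periodic function `b(t) = φ(t - ⌊t⌋)`. -/
def periodisation (φ : ℝ → ℝ) (t : ℝ) : ℝ := φ (t - (⌊t⌋ : ℝ))

/-- The profiles `φ`: real, smooth, supported in `(0,1)`, not identically zero, `|φ| < 1`. -/
structure IsProfile (φ : ℝ → ℝ) : Prop where
  smooth : ContDiff ℝ ∞ φ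
  support : tsupport φ ⊆ Ioo 0 1
  ne_zero : φ ≠ 0
  abs_lt_one : ∀ t, |φ t| < 1

/-- Admissible parameters `τ_k, δ_k, n_k`, indexed by `k = 1, 2, 3, …` (the value at `k = 0`
is never used). -/
structure IsAdmissible (τ δ : ℕ → ℝ) (n : ℕ → ℕ) : Prop where
  start_nonneg : 0 ≤ τ 1
  length_pos : ∀ k, 1 ≤ k → 0 < δ k
  count_pos : ∀ k, 1 ≤ k → 0 < n k
  separated : ∀ k, 1 ≤ k → τ k + δ k < τ (k + 1)
  tendsto : Tendsto τ atTop atTop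

open Classical in
/-- The coefficient `a(t)`: it equals `1 + b(n_k (t - τ_k) / δ_k)` if
`t ∈ [τ_k, τ_k + δ_k]` for some `k ≥ 1` (such a `k` is unique for admissible parameters),
and it equals `1` otherwise. -/
def coefficient (φ : ℝ → ℝ) (τ δ : ℕ → ℝ) (n : ℕ → ℕ) (t : ℝ) : ℝ :=
  if h : ∃ k, 1 ≤ k ∧ t ∈ Icc (τ k) (τ k + δ k) then
    1 + periodisation φ ((n h.choose : ℝ) / δ h.choose * (t - τ h.choose))
  else 1

/-- The space `ℝᵈ`. -/
abbrev Space (d : ℕ) : Type := EuclideanSpace ℝ (Fin d)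

/-- The energy `½ ∫ (|∇f|² + |g|²) dx` of a state with displacement `f` and velocity `g`. -/
def energy {d : ℕ} (f g : 𝓢(Space d, ℂ)) : ℝ :=
  (1 / 2) * ∫ x, ((∑ j, ‖(∂_{(EuclideanSpace.single j 1 : Space d)} f) x‖ ^ 2) + ‖g x‖ ^ 2)

/-- `u`, with time derivative `v = u_t`, solves `u_tt - a(t)² Δu = 0` for `t ≥ 0` with
`u(0) = u₀`, `u_t(0) = u₁`, as a twice differentiable curve in the Schwartz space. (For
Schwartz data and smooth positive `a` this is the unique classical solution.) -/
structure IsWaveSolution {d : ℕ} (a : ℝ → ℝ) (u₀ u₁ : 𝓢(Space d, ℂ))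
    (u v : ℝ → 𝓢(Space d, ℂ)) : Prop where
  init_pos : u 0 = u₀
  init_vel : v 0 = u₁
  deriv_pos : ∀ t, 0 ≤ t → HasDerivWithinAt u (v t) (Ici 0) t
  deriv_vel : ∀ t, 0 ≤ t → HasDerivWithinAt v ((a t ^ 2) • Δ (u t)) (Ici 0) t

/-- On the `k`-th interval the coefficient is given by the `k`-th rescaled oscillation. -/
theorem coefficient_of_mem {φ : ℝ → ℝ} {τ δ : ℕ → ℝ} {n : ℕ → ℕ} (h : IsAdmissible τ δ n)
    {k : ℕ} (hk : 1 ≤ k) {t : ℝ} (ht : t ∈ Icc (τ k) (τ k + δ k)) :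
    coefficient φ τ δ n t = 1 + periodisation φ ((n k : ℝ) / δ k * (t - τ k)) := by
  have hlt : ∀ i, 1 ≤ i → ∀ m, τ i + δ i < τ (i + 1 + m) := by
    intro i hi m
    induction m with
    | zero => exact h.separated i hi
    | succ m ih =>
      have h1 := h.separated (i + 1 + m) (by omega)
      have h2 := h.length_pos (i + 1 + m) (by omega)
      have h3 : τ (i + 1 + (m + 1)) = τ (i + 1 + m + 1) := rfl
      linarith
  have hdis : ∀ i j, 1 ≤ i → i < j → t ∈ Icc (τ i) (τ i + δ i) →
      t ∈ Icc (τ j) (τ j + δ j) → False := by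
    intro i j hi hij h1 h2
    obtain ⟨m, rfl⟩ := Nat.exists_eq_add_of_le (Nat.succ_le_of_lt hij)
    have h3 := hlt i hi m
    have h4 := h1.2
    have h5 := h2.1
    simp only [Nat.succ_eq_add_one] at h5
    linarith
  have hex : ∃ k, 1 ≤ k ∧ t ∈ Icc (τ k) (τ k + δ k) := ⟨k, hk, ht⟩
  have hc : hex.choose = k := by
    rcases lt_trichotomy hex.choose k with hl | he | hg
    · exact (hdis _ _ hex.choose_spec.1 hl hex.choose_spec.2 ht).elim
    · exact he
    · exact (hdis _ _ hk hg ht hex.choose_spec.2).elim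
  unfold coefficient
  rw [dif_pos hex, hc]

end

/-!
In frequency space the wave equation becomes the family of oscillators `w'' = -ρ² a² w` with
`ρ = 2π‖ξ‖`, and on each interval `I_k` such an oscillator is, up to rescaling time, `n_k` periods
of the Hill equation `w'' = -l² (1 + φ)² w`. This equation is unstable for some `l`. Indeed its
discriminant `D(z)`, for `w'' = z a² w`, is entire of order `1/2` with `|D(z²)|` growing at most
like `exp (|Re z| ∫ a)`. If `|D| ≤ 2` on the negative axis, then Phragmén–Lindelöf applied to the
Chebyshev polynomials of `D / 2` gives `D(y²) ≤ 2 cosh (y ∫ a)`, whereas Picard iteration gives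
`D(y²) ≥ 2 + y² ∫ a²`; as `y → 0` this forces `∫ a² ≤ (∫ a)²` over the unit interval, so that `a`
is constant.

Near an unstable frequency the monodromy matrix multiplies the energy of a suitable state by at
least `exp (2 κ)` per period, and so the `k`-th interval multiplies it by at least `exp (2 κ n_k)`.
The energy weighted by `a` shows that the earlier intervals cost at most `exp (2 c ∑ n_l)`. Data
prescribed at time `τ_k` and supported near the resonant frequencies therefore grow as claimed, and
for rapidly growing `n_k` the gain beats the loss.
-/

/-! ### Power series in the spectral parameter -/

/-- `ExpBounded C M c` says that the real sequence `c` is dominated by the coefficients of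
`C * exp (M z)`, so that `∑ c k z ^ k` is entire. -/
def ExpBounded (C M : ℝ) (c : ℕ → ℝ) : Prop :=
  ∀ k, |c k| ≤ C * (M ^ k / k.factorial)

section ExpBounded

variable {𝕜 : Type*} [RCLike 𝕜] {C M : ℝ}

theorem summable_mul_pow_div_factorial (C M : ℝ) :
    Summable fun k : ℕ => C * (M ^ k / k.factorial) :=
  (Real.summable_pow_div_factorial M).mul_left C

theorem ExpBounded.norm_mul_pow_le {c : ℕ → ℝ} (hc : ExpBounded C M c) {R : ℝ} {z : 𝕜}
    (hz : ‖z‖ ≤ R) (k : ℕ) : ‖(c k : 𝕜) * z ^ k‖ ≤ C * ((M * R) ^ k / k.factorial) := by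
  have hbound_nonneg : 0 ≤ C * (M ^ k / k.factorial) := (abs_nonneg _).trans (hc k)
  calc ‖(c k : 𝕜) * z ^ k‖ = |c k| * ‖z‖ ^ k := by rw [norm_mul, norm_pow, RCLike.norm_ofReal]
    _ ≤ C * (M ^ k / k.factorial) * R ^ k := by gcongr; exact hc k
    _ = C * ((M * R) ^ k / k.factorial) := by rw [mul_pow]; ring

theorem ExpBounded.summable_mul_pow {c : ℕ → ℝ} (hc : ExpBounded C M c) (z : 𝕜) :
    Summable fun k => (c k : 𝕜) * z ^ k :=
  .of_norm_bounded (summable_mul_pow_div_factorial C (M * ‖z‖)) (hc.norm_mul_pow_le le_rfl)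

theorem ExpBounded.differentiable_tsum_mul_pow {c : ℕ → ℝ} (hc : ExpBounded C M c) :
    Differentiable ℂ fun z : ℂ => ∑' k, (c k : ℂ) * z ^ k := by
  intro z
  have hz : z ∈ Metric.ball (0 : ℂ) (‖z‖ + 1) := mem_ball_zero_iff.2 (lt_add_one _)
  exact (Complex.differentiableOn_tsum_of_summable_norm
    (summable_mul_pow_div_factorial C (M * (‖z‖ + 1))) (fun k => by fun_prop) Metric.isOpen_ball
    (fun k w hw => hc.norm_mul_pow_le (mem_ball_zero_iff.1 hw).le k)).differentiableAt
    (Metric.isOpen_ball.mem_nhds hz)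

theorem hasDerivAt_tsum_mul_pow {c c' : ℕ → ℝ → ℝ} {t₀ : ℝ}
    (hd : ∀ k t, HasDerivAt (c k) (c' k t) t)
    (hbound : ∀ T, ∃ C M, ∀ t, |t - t₀| ≤ T →
      ExpBounded C M (c · t) ∧ ExpBounded C M (c' · t)) (z : 𝕜) (t : ℝ) :
    HasDerivAt (fun s => ∑' k, (c k s : 𝕜) * z ^ k) (∑' k, (c' k t : 𝕜) * z ^ k) t := by
  obtain ⟨C, M, hCM⟩ := hbound (|t - t₀| + 1)
  have hball : ∀ s ∈ Metric.ball t₀ (|t - t₀| + 1), |s - t₀| ≤ |t - t₀| + 1 := fun s hs =>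
    (Metric.mem_ball.1 hs).le
  have ht : t ∈ Metric.ball t₀ (|t - t₀| + 1) := Metric.mem_ball.2 (lt_add_one _)
  exact hasDerivAt_tsum_of_isPreconnected (summable_mul_pow_div_factorial C (M * ‖z‖))
    Metric.isOpen_ball (convex_ball _ _).isPreconnected
    (fun k s _ => ((RCLike.ofRealCLM (K := 𝕜)).hasFDerivAt.comp_hasDerivAt s
      (hd k s)).mul_const (z ^ k))
    (fun k s hs => (hCM s (hball s hs)).2.norm_mul_pow_le le_rfl k) ht
    ((hCM t (hball t ht)).1.summable_mul_pow z) ht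

end ExpBounded

/-- The coefficient of `z ^ k` in the solution of `w'' = z A w`, `w t₀ = x`, `w' t₀ = y`, as
produced by Picard iteration. -/
noncomputable def posTerm (A : ℝ → ℝ) (t₀ x y : ℝ) : ℕ → ℝ → ℝ
  | 0 => fun t => x + y * (t - t₀)
  | k + 1 => fun t => ∫ s in t₀..t, ∫ r in t₀..s, A r * posTerm A t₀ x y k r

/-- The time derivative of `posTerm`. -/
noncomputable def velTerm (A : ℝ → ℝ) (t₀ x y : ℝ) : ℕ → ℝ → ℝ
  | 0 => fun _ => y
  | k + 1 => fun t => ∫ r in t₀..t, A r * posTerm A t₀ x y k r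

/-- The second time derivative of `posTerm`. -/
noncomputable def accTerm (A : ℝ → ℝ) (t₀ x y : ℝ) : ℕ → ℝ → ℝ
  | 0 => fun _ => 0
  | k + 1 => fun t => A t * posTerm A t₀ x y k t

section PicardTerms

variable {A : ℝ → ℝ} {t₀ x y : ℝ}

theorem continuous_posTerm (hA : Continuous A) (k : ℕ) : Continuous (posTerm A t₀ x y k) := by
  induction k with
  | zero => simp only [posTerm]; fun_prop
  | succ k ih =>
    have hvel : Continuous (velTerm A t₀ x y (k + 1)) :=
      intervalIntegral.continuous_primitive (fun a b => (hA.mul ih).intervalIntegrable a b) t₀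
    exact intervalIntegral.continuous_primitive (fun a b => hvel.intervalIntegrable a b) t₀

theorem hasDerivAt_velTerm (hA : Continuous A) (k : ℕ) (t : ℝ) :
    HasDerivAt (velTerm A t₀ x y k) (accTerm A t₀ x y k t) t := by
  cases k with
  | zero => exact hasDerivAt_const t y
  | succ k => exact ((hA.mul (continuous_posTerm hA k)).integral_hasStrictDerivAt t₀ t).hasDerivAt

theorem continuous_velTerm (hA : Continuous A) (k : ℕ) : Continuous (velTerm A t₀ x y k) :=
  continuous_iff_continuousAt.2 fun t => (hasDerivAt_velTerm hA k t).continuousAt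

theorem hasDerivAt_posTerm (hA : Continuous A) (k : ℕ) (t : ℝ) :
    HasDerivAt (posTerm A t₀ x y k) (velTerm A t₀ x y k t) t := by
  cases k with
  | zero =>
    simp only [posTerm, velTerm]
    simpa using (((hasDerivAt_id t).sub_const t₀).const_mul y).const_add x
  | succ k => exact ((continuous_velTerm hA (k + 1)).integral_hasStrictDerivAt t₀ t).hasDerivAt

theorem abs_integral_le_pow_div_factorial {f : ℝ → ℝ} {C t : ℝ} {k : ℕ}
    (hf : ∀ s ∈ uIcc t₀ t, |f s| ≤ C * (|s - t₀| ^ k / k.factorial)) :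
    |∫ s in t₀..t, f s| ≤ C * (|t - t₀| ^ (k + 1) / (k + 1).factorial) := by
  have hpow : MeasureTheory.IntegrableOn (fun s => |s - t₀| ^ k) (uIoc t₀ t) :=
    (Continuous.intervalIntegrable (by fun_prop) t₀ t).def'
  calc |∫ s in t₀..t, f s| ≤ ∫ s in uIoc t₀ t, C / k.factorial * |s - t₀| ^ k := by
        rw [← Real.norm_eq_abs]
        refine (intervalIntegral.norm_integral_eq_norm_integral_uIoc f).trans_le ?_
        refine MeasureTheory.norm_integral_le_of_norm_le (hpow.const_mul _) ?_
        filter_upwards [MeasureTheory.ae_restrict_mem measurableSet_uIoc] with s hs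
        exact (hf s (uIoc_subset_uIcc hs)).trans_eq (by ring)
    _ = C * (|t - t₀| ^ (k + 1) / (k + 1).factorial) := by
        rw [MeasureTheory.integral_const_mul, integral_pow_abs_sub_uIoc, Nat.factorial_succ]
        push_cast
        field_simp

theorem abs_sub_le_of_mem_uIcc {s t : ℝ} (hs : s ∈ uIcc t₀ t) : |s - t₀| ≤ |t - t₀| := by
  simpa only [abs_sub_comm] using abs_sub_left_of_mem_uIcc hs

theorem abs_velTerm_succ_le {K T D : ℝ} (hK : ∀ s, |s - t₀| ≤ T → |A s| ≤ K) {k : ℕ}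
    (hpos : ∀ s, |s - t₀| ≤ T → |posTerm A t₀ x y k s| ≤ D * (|s - t₀| ^ k / k.factorial))
    {t : ℝ} (ht : |t - t₀| ≤ T) :
    |velTerm A t₀ x y (k + 1) t| ≤ K * D * (|t - t₀| ^ (k + 1) / (k + 1).factorial) := by
  refine abs_integral_le_pow_div_factorial fun s hs => ?_
  have hsT : |s - t₀| ≤ T := (abs_sub_le_of_mem_uIcc hs).trans ht
  rw [abs_mul, mul_assoc]
  exact mul_le_mul (hK s hsT) (hpos s hsT) (abs_nonneg _) ((abs_nonneg _).trans (hK s hsT))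

theorem abs_posTerm_le {K T : ℝ} (hK : ∀ s, |s - t₀| ≤ T → |A s| ≤ K) (k : ℕ) {t : ℝ}
    (ht : |t - t₀| ≤ T) :
    |posTerm A t₀ x y k t| ≤ (|x| + |y| * T) * (K * T) ^ k * (|t - t₀| ^ k / k.factorial) := by
  have hT : 0 ≤ T := (abs_nonneg _).trans ht
  have hK0 : 0 ≤ K := (abs_nonneg _).trans (hK t ht)
  induction k generalizing t with
  | zero =>
    simp only [posTerm, pow_zero, Nat.factorial_zero, Nat.cast_one, div_one, mul_one]
    refine (abs_add_le _ _).trans ?_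
    rw [abs_mul]
    gcongr
  | succ k ih =>
    set D := (|x| + |y| * T) * (K * T) ^ k
    have hvel : ∀ s ∈ uIcc t₀ t, |velTerm A t₀ x y (k + 1) s| ≤
        K * D * (|t - t₀| ^ (k + 1) / (k + 1).factorial) := fun s hs => by
      have hst := abs_sub_le_of_mem_uIcc hs
      refine (abs_velTerm_succ_le hK (fun s hs => ih hs) (hst.trans ht)).trans ?_
      gcongr
    calc |posTerm A t₀ x y (k + 1) t|
        ≤ K * D * (|t - t₀| ^ (k + 1) / (k + 1).factorial) * |t - t₀| :=
          intervalIntegral.norm_integral_le_of_norm_le_const (f := velTerm A t₀ x y (k + 1))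
            fun s hs => hvel s (uIoc_subset_uIcc hs)
      _ ≤ K * D * (|t - t₀| ^ (k + 1) / (k + 1).factorial) * T := by gcongr
      _ = (|x| + |y| * T) * (K * T) ^ (k + 1) * (|t - t₀| ^ (k + 1) / (k + 1).factorial) := by
        ring

theorem expBounded_posTerm {K T : ℝ} (hK : ∀ s, |s - t₀| ≤ T → |A s| ≤ K) {t : ℝ}
    (ht : |t - t₀| ≤ T) : ExpBounded (|x| + |y| * T) (K * T * T) (posTerm A t₀ x y · t) := by
  have hT : 0 ≤ T := (abs_nonneg _).trans ht
  have hK0 : 0 ≤ K := (abs_nonneg _).trans (hK t ht)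
  intro k
  calc |posTerm A t₀ x y k t|
      ≤ (|x| + |y| * T) * (K * T) ^ k * (|t - t₀| ^ k / k.factorial) := abs_posTerm_le hK k ht
    _ ≤ (|x| + |y| * T) * (K * T) ^ k * (T ^ k / k.factorial) := by gcongr
    _ = (|x| + |y| * T) * ((K * T * T) ^ k / k.factorial) := by rw [mul_pow (K * T)]; ring

theorem succ_mul_pow_le_add_one_pow {m : ℝ} (hm : 0 ≤ m) (k : ℕ) :
    (k + 1) * m ^ k ≤ (m + 1) ^ (k + 1) := by
  rw [add_pow]
  refine le_trans (le_of_eq ?_) (Finset.single_le_sum (f := fun j =>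
    m ^ j * 1 ^ (k + 1 - j) * ((k + 1).choose j : ℝ)) (fun j _ => by positivity)
    (Finset.mem_range.2 (by omega : k < k + 1 + 1)))
  simp [mul_comm]

theorem pow_div_factorial_le_succ {m : ℝ} (hm : 0 ≤ m) (k : ℕ) :
    m ^ k / k.factorial ≤ (m + 1) ^ (k + 1) / (k + 1).factorial := by
  rw [Nat.factorial_succ, div_le_div_iff₀ (by positivity) (by positivity)]
  push_cast
  nlinarith [mul_le_mul_of_nonneg_right (succ_mul_pow_le_add_one_pow hm k)
    (Nat.cast_nonneg (α := ℝ) k.factorial)]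

theorem exists_expBounded_terms (hA : Continuous A) (t₀ x y T : ℝ) :
    ∃ C M : ℝ, ∀ t, |t - t₀| ≤ T → ExpBounded C M (posTerm A t₀ x y · t) ∧
      ExpBounded C M (velTerm A t₀ x y · t) ∧ ExpBounded C M (accTerm A t₀ x y · t) := by
  obtain ⟨K, hK⟩ : ∃ K, ∀ s, |s - t₀| ≤ T → |A s| ≤ K := by
    obtain ⟨K, hK⟩ := (isCompact_closedBall t₀ T).exists_bound_of_continuousOn hA.continuousOn
    exact ⟨K, fun s hs => hK s hs⟩
  set B := |x| + |y| * T
  set m := K * T * T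
  refine ⟨B + |y| + K * B * T + K * B, m + 1, fun t ht => ?_⟩
  have hT : 0 ≤ T := (abs_nonneg _).trans ht
  have hK0 : 0 ≤ K := (abs_nonneg _).trans (hK t ht)
  have hB : 0 ≤ B := by positivity
  have hm : 0 ≤ m := by positivity
  have hBy : 0 ≤ B + |y| := by positivity
  have hKBT : 0 ≤ K * B * T := by positivity
  have hKB : 0 ≤ K * B := by positivity
  have hpos : ∀ k, |posTerm A t₀ x y k t| ≤ B * (m ^ k / k.factorial) := fun k =>
    expBounded_posTerm hK ht k
  refine ⟨fun k => (hpos k).trans ?_, ?_, ?_⟩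
  · gcongr <;> linarith [abs_nonneg y]
  · rintro (_ | k)
    · simp only [velTerm, pow_zero, Nat.factorial_zero, Nat.cast_one, div_one, mul_one]
      linarith
    calc |velTerm A t₀ x y (k + 1) t|
        ≤ K * (B * (K * T) ^ k) * (|t - t₀| ^ (k + 1) / (k + 1).factorial) :=
          abs_velTerm_succ_le hK (fun s hs => abs_posTerm_le hK k hs) ht
      _ ≤ K * (B * (K * T) ^ k) * (T ^ (k + 1) / k.factorial) := by gcongr; exact Nat.le_succ k
      _ = K * B * T * (m ^ k / k.factorial) := by rw [mul_pow (K * T)]; ring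
      _ ≤ _ := by
        gcongr ?_ * ?_
        · linarith
        · exact pow_div_factorial_le_succ hm k
  · rintro (_ | k)
    · simp only [accTerm, abs_zero]
      positivity
    calc |accTerm A t₀ x y (k + 1) t| = |A t| * |posTerm A t₀ x y k t| := abs_mul _ _
      _ ≤ K * (B * (m ^ k / k.factorial)) :=
        mul_le_mul (hK t ht) (hpos k) (abs_nonneg _) hK0
      _ ≤ (B + |y| + K * B * T + K * B) * ((m + 1) ^ (k + 1) / (k + 1).factorial) := by
        rw [← mul_assoc]
        gcongr ?_ * ?_
        · linarith
        · exact pow_div_factorial_le_succ hm k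

end PicardTerms

/-- The solution of `w'' = z A w`, `w t₀ = x`, `w' t₀ = y`, as a power series in `z`. -/
noncomputable def odeSol {𝕜 : Type*} [RCLike 𝕜] (A : ℝ → ℝ) (t₀ x y : ℝ) (z : 𝕜) (t : ℝ) : 𝕜 :=
  ∑' k, (posTerm A t₀ x y k t : 𝕜) * z ^ k

/-- The time derivative of `odeSol`. -/
noncomputable def odeSolDeriv {𝕜 : Type*} [RCLike 𝕜] (A : ℝ → ℝ) (t₀ x y : ℝ) (z : 𝕜) (t : ℝ) :
    𝕜 :=
  ∑' k, (velTerm A t₀ x y k t : 𝕜) * z ^ k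

section OdeSol

variable {𝕜 : Type*} [RCLike 𝕜] {A : ℝ → ℝ} {t₀ x y : ℝ}

theorem hasSum_odeSol (hA : Continuous A) (z : 𝕜) (t : ℝ) :
    HasSum (fun k => (posTerm A t₀ x y k t : 𝕜) * z ^ k) (odeSol A t₀ x y z t) := by
  obtain ⟨C, M, hCM⟩ := exists_expBounded_terms hA t₀ x y |t - t₀|
  exact ((hCM t le_rfl).1.summable_mul_pow z).hasSum

theorem hasSum_odeSolDeriv (hA : Continuous A) (z : 𝕜) (t : ℝ) :
    HasSum (fun k => (velTerm A t₀ x y k t : 𝕜) * z ^ k) (odeSolDeriv A t₀ x y z t) := by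
  obtain ⟨C, M, hCM⟩ := exists_expBounded_terms hA t₀ x y |t - t₀|
  exact ((hCM t le_rfl).2.1.summable_mul_pow z).hasSum

theorem hasDerivAt_odeSol (hA : Continuous A) (z : 𝕜) (t : ℝ) :
    HasDerivAt (odeSol A t₀ x y z) (odeSolDeriv A t₀ x y z t) t := by
  refine hasDerivAt_tsum_mul_pow (t₀ := t₀) (hasDerivAt_posTerm hA) (fun T => ?_) z t
  obtain ⟨C, M, hCM⟩ := exists_expBounded_terms hA t₀ x y T
  exact ⟨C, M, fun s hs => ⟨(hCM s hs).1, (hCM s hs).2.1⟩⟩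

theorem tsum_accTerm (hA : Continuous A) (z : 𝕜) (t : ℝ) :
    ∑' k, (accTerm A t₀ x y k t : 𝕜) * z ^ k = z * A t * odeSol A t₀ x y z t := by
  obtain ⟨C, M, hCM⟩ := exists_expBounded_terms hA t₀ x y |t - t₀|
  rw [((hCM t le_rfl).2.2.summable_mul_pow z).tsum_eq_zero_add, odeSol, ← tsum_mul_left]
  simp only [accTerm, RCLike.ofReal_zero, zero_mul, zero_add, RCLike.ofReal_mul, pow_succ]
  exact tsum_congr fun k => by ring

theorem hasDerivAt_odeSolDeriv (hA : Continuous A) (z : 𝕜) (t : ℝ) :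
    HasDerivAt (odeSolDeriv A t₀ x y z) (z * A t * odeSol A t₀ x y z t) t := by
  rw [← tsum_accTerm hA]
  refine hasDerivAt_tsum_mul_pow (t₀ := t₀) (hasDerivAt_velTerm hA) (fun T => ?_) z t
  obtain ⟨C, M, hCM⟩ := exists_expBounded_terms hA t₀ x y T
  exact ⟨C, M, fun s hs => (hCM s hs).2⟩

@[simp]
theorem odeSol_self (z : 𝕜) : odeSol A t₀ x y z t₀ = x := by
  rw [odeSol, tsum_eq_single 0]
  · simp [posTerm]
  · rintro (_ | k) hk
    · exact absurd rfl hk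
    · simp [posTerm]

@[simp]
theorem odeSolDeriv_self (z : 𝕜) : odeSolDeriv A t₀ x y z t₀ = y := by
  rw [odeSolDeriv, tsum_eq_single 0]
  · simp [velTerm]
  · rintro (_ | k) hk
    · exact absurd rfl hk
    · simp [velTerm]

theorem ofReal_odeSol (z t : ℝ) :
    ((odeSol A t₀ x y z t : ℝ) : 𝕜) = odeSol A t₀ x y (z : 𝕜) t := by
  simp [odeSol, RCLike.ofReal_tsum]

theorem ofReal_odeSolDeriv (z t : ℝ) :
    ((odeSolDeriv A t₀ x y z t : ℝ) : 𝕜) = odeSolDeriv A t₀ x y (z : 𝕜) t := by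
  simp [odeSolDeriv, RCLike.ofReal_tsum]

theorem differentiable_odeSol_param (hA : Continuous A) (t : ℝ) :
    Differentiable ℂ fun z : ℂ => odeSol A t₀ x y z t := by
  obtain ⟨C, M, hCM⟩ := exists_expBounded_terms hA t₀ x y |t - t₀|
  exact (hCM t le_rfl).1.differentiable_tsum_mul_pow

theorem differentiable_odeSolDeriv_param (hA : Continuous A) (t : ℝ) :
    Differentiable ℂ fun z : ℂ => odeSolDeriv A t₀ x y z t := by
  obtain ⟨C, M, hCM⟩ := exists_expBounded_terms hA t₀ x y |t - t₀|
  exact (hCM t le_rfl).2.1.differentiable_tsum_mul_pow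

theorem continuous_of_ofReal_eq {f : ℝ → ℝ} {F : ℂ → ℂ} (hF : Continuous F)
    (hfF : ∀ x : ℝ, (f x : ℂ) = F x) : Continuous f := by
  rw [← Complex.isometry_ofReal.comp_continuous_iff]
  exact (hF.comp Complex.continuous_ofReal).congr fun x => (hfF x).symm

theorem continuous_odeSol_param (hA : Continuous A) (t : ℝ) :
    Continuous fun z : ℝ => odeSol A t₀ x y z t :=
  continuous_of_ofReal_eq (differentiable_odeSol_param hA t).continuous (ofReal_odeSol · t)

theorem continuous_odeSolDeriv_param (hA : Continuous A) (t : ℝ) :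
    Continuous fun z : ℝ => odeSolDeriv A t₀ x y z t :=
  continuous_of_ofReal_eq (differentiable_odeSolDeriv_param hA t).continuous
    (ofReal_odeSolDeriv · t)

end OdeSol

theorem lipschitzWith_snd_smul_fst {F : Type*} [NormedAddCommGroup F] [NormedSpace ℝ F]
    {c K : ℝ} (hc : |c| ≤ K) :
    LipschitzWith (max 1 K).toNNReal fun p : F × F => (p.2, c • p.1) := by
  have hmax : 0 ≤ max 1 K := zero_le_one.trans (le_max_left 1 K)
  refine LipschitzWith.of_dist_le_mul fun p q => ?_
  rw [Real.coe_toNNReal _ hmax, Prod.dist_eq, Prod.dist_eq]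
  refine max_le ?_ ?_
  · exact (le_max_right _ _).trans (le_mul_of_one_le_left
      (dist_nonneg.trans (le_max_left _ _)) (le_max_left 1 K))
  · rw [dist_smul₀, Real.norm_eq_abs]
    exact mul_le_mul (hc.trans (le_max_right 1 K)) (le_max_left _ _) dist_nonneg hmax

theorem secondOrderODE_solution_unique {F : Type*} [NormedAddCommGroup F] [NormedSpace ℝ F]
    {c : ℝ → ℝ} {a b : ℝ} (hc : ContinuousOn c (Icc a b)) {w₁ v₁ w₂ v₂ : ℝ → F}
    (hw₁ : ∀ t ∈ Icc a b, HasDerivWithinAt w₁ (v₁ t) (Icc a b) t)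
    (hv₁ : ∀ t ∈ Icc a b, HasDerivWithinAt v₁ (c t • w₁ t) (Icc a b) t)
    (hw₂ : ∀ t ∈ Icc a b, HasDerivWithinAt w₂ (v₂ t) (Icc a b) t)
    (hv₂ : ∀ t ∈ Icc a b, HasDerivWithinAt v₂ (c t • w₂ t) (Icc a b) t)
    (hw : w₁ a = w₂ a) (hv : v₁ a = v₂ a) :
    ∀ t ∈ Icc a b, w₁ t = w₂ t ∧ v₁ t = v₂ t := by
  obtain ⟨K, hK⟩ := isCompact_Icc.exists_bound_of_continuousOn hc
  have hright : ∀ {f : ℝ → F × F} {f' : F × F} {s : ℝ}, s ∈ Ico a b →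
      HasDerivWithinAt f f' (Icc a b) s → HasDerivWithinAt f f' (Ici s) s := fun hs h =>
    h.mono_of_mem_nhdsWithin (mem_of_superset (Icc_mem_nhdsGE hs.2) (Icc_subset_Icc_left hs.1))
  have hd₁ : ∀ t ∈ Icc a b, HasDerivWithinAt (fun s => (w₁ s, v₁ s)) (v₁ t, c t • w₁ t)
      (Icc a b) t := fun t ht => (hw₁ t ht).prodMk (hv₁ t ht)
  have hd₂ : ∀ t ∈ Icc a b, HasDerivWithinAt (fun s => (w₂ s, v₂ s)) (v₂ t, c t • w₂ t)
      (Icc a b) t := fun t ht => (hw₂ t ht).prodMk (hv₂ t ht)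
  have heq : EqOn (fun s => (w₁ s, v₁ s)) (fun s => (w₂ s, v₂ s)) (Icc a b) :=
    ODE_solution_unique_of_mem_Icc_right (v := fun t p => (p.2, c t • p.1)) (s := fun _ => univ)
      (fun t ht => (lipschitzWith_snd_smul_fst (hK t (Ico_subset_Icc_self ht))).lipschitzOnWith)
      (fun t ht => (hd₁ t ht).continuousWithinAt)
      (fun t ht => hright ht (hd₁ t (Ico_subset_Icc_self ht))) (fun _ _ => mem_univ _)
      (fun t ht => (hd₂ t ht).continuousWithinAt)
      (fun t ht => hright ht (hd₂ t (Ico_subset_Icc_self ht))) (fun _ _ => mem_univ _)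
      (Prod.ext hw hv)
  exact fun t ht => Prod.mk_inj.1 (heq ht)

/-! ### The Hill discriminant -/

theorem mul_exp_sub_le_of_mul_le_deriv {E E' P p : ℝ → ℝ} {s t : ℝ} (hst : s ≤ t)
    (hE : ∀ r, HasDerivAt E (E' r) r) (hP : ∀ r, HasDerivAt P (p r) r)
    (hle : ∀ r ∈ Ioo s t, p r * E r ≤ E' r) : E s * Real.exp (P t - P s) ≤ E t := by
  have hd : ∀ r, HasDerivAt (fun r => E r * Real.exp (-P r))
      ((E' r - p r * E r) * Real.exp (-P r)) r := fun r =>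
    ((hE r).mul (hP r).neg.exp).congr_deriv (by simp only [Pi.neg_apply]; ring)
  have hmono : MonotoneOn (fun r => E r * Real.exp (-P r)) (Icc s t) := by
    refine monotoneOn_of_deriv_nonneg (convex_Icc s t)
      (fun r _ => (hd r).continuousAt.continuousWithinAt)
      (fun r _ => (hd r).differentiableAt.differentiableWithinAt) fun r hr => ?_
    rw [interior_Icc] at hr
    rw [(hd r).deriv]
    exact mul_nonneg (sub_nonneg.2 (hle r hr)) (Real.exp_pos _).le
  have hends := hmono (left_mem_Icc.2 hst) (right_mem_Icc.2 hst) hst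
  calc E s * Real.exp (P t - P s) = E s * Real.exp (-P s) * Real.exp (P t) := by
        rw [mul_assoc, ← Real.exp_add]; ring_nf
    _ ≤ E t * Real.exp (-P t) * Real.exp (P t) := by gcongr
    _ = E t := by rw [mul_assoc, ← Real.exp_add, neg_add_cancel, Real.exp_zero, mul_one]

theorem le_mul_exp_sub_of_deriv_le_mul {E E' P p : ℝ → ℝ} {s t : ℝ} (hst : s ≤ t)
    (hE : ∀ r, HasDerivAt E (E' r) r) (hP : ∀ r, HasDerivAt P (p r) r)
    (hle : ∀ r ∈ Ioo s t, E' r ≤ p r * E r) : E t ≤ E s * Real.exp (P t - P s) := by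
  have := mul_exp_sub_le_of_mul_le_deriv hst (fun r => (hE r).neg) hP fun r hr => by
    simpa only [Pi.neg_apply, mul_neg, neg_le_neg_iff] using hle r hr
  simpa only [Pi.neg_apply, neg_mul, neg_le_neg_iff] using this

/-- The adiabatic energy of the state `(w, v)` of the oscillator `w'' = z² a² w`; it is conserved
when `a` is constant and `z` is imaginary. -/
noncomputable def hillEnergy (a : ℝ → ℝ) (z : ℂ) (w v : ℝ → ℂ) (t : ℝ) : ℝ :=
  ‖v t‖ ^ 2 + ‖z‖ ^ 2 * a t ^ 2 * ‖w t‖ ^ 2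

section HillEnergy

variable {a : ℝ → ℝ} {z : ℂ} {w v : ℝ → ℂ}

theorem inner_sq_mul_add_norm_sq_mul_inner (z w v : ℂ) :
    inner ℝ v (z ^ 2 * w) + ‖z‖ ^ 2 * inner ℝ w v
      = 2 * z.re * (z * starRingEnd ℂ v * w).re := by
  rw [Complex.inner, Complex.inner, ← Complex.normSq_eq_norm_sq, Complex.normSq_apply]
  simp only [pow_two, Complex.mul_re, Complex.mul_im, Complex.conj_re, Complex.conj_im]
  ring

theorem hasDerivAt_hillEnergy {t : ℝ} (ha : DifferentiableAt ℝ a t) (hw : HasDerivAt w (v t) t)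
    (hv : HasDerivAt v (z ^ 2 * (a t ^ 2 : ℝ) * w t) t) :
    HasDerivAt (hillEnergy a z w v)
      (4 * z.re * a t ^ 2 * (z * starRingEnd ℂ (v t) * w t).re
        + 2 * ‖z‖ ^ 2 * (a t * deriv a t) * ‖w t‖ ^ 2) t := by
  have hcross := inner_sq_mul_add_norm_sq_mul_inner z (w t) (v t)
  have hsmul : inner ℝ (v t) (z ^ 2 * (a t ^ 2 : ℝ) * w t)
      = a t ^ 2 * inner ℝ (v t) (z ^ 2 * w t) := by
    rw [← real_inner_smul_right, Complex.real_smul]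
    congr 1
    ring
  refine (hv.norm_sq.add (((ha.hasDerivAt.pow 2).const_mul (‖z‖ ^ 2)).mul hw.norm_sq)).congr_deriv
    ?_
  simp only [hsmul, Pi.pow_apply]
  push_cast
  linear_combination 2 * a t ^ 2 * hcross

theorem abs_deriv_hillEnergy_le (z w v : ℂ) {α α' γ : ℝ} (hα : 0 < α) (hlog : |α'| ≤ γ * α) :
    |4 * z.re * α ^ 2 * (z * starRingEnd ℂ v * w).re + 2 * ‖z‖ ^ 2 * (α * α') * ‖w‖ ^ 2|
      ≤ 2 * (|z.re| * α + γ) * (‖v‖ ^ 2 + ‖z‖ ^ 2 * α ^ 2 * ‖w‖ ^ 2) := by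
  have hγ : 0 ≤ γ := nonneg_of_mul_nonneg_left ((abs_nonneg _).trans hlog) hα
  have hre : |(z * starRingEnd ℂ v * w).re| ≤ ‖z‖ * ‖v‖ * ‖w‖ := by
    simpa only [norm_mul, RCLike.norm_conj] using Complex.abs_re_le_norm (z * starRingEnd ℂ v * w)
  have hamgm : 2 * ‖v‖ * (α * ‖z‖ * ‖w‖) ≤ ‖v‖ ^ 2 + (α * ‖z‖ * ‖w‖) ^ 2 := two_mul_le_add_sq _ _
  have hfirst : |4 * z.re * α ^ 2 * (z * starRingEnd ℂ v * w).re|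
      ≤ 2 * (|z.re| * α) * (‖v‖ ^ 2 + ‖z‖ ^ 2 * α ^ 2 * ‖w‖ ^ 2) := by
    calc |4 * z.re * α ^ 2 * (z * starRingEnd ℂ v * w).re|
        = 4 * |z.re| * α ^ 2 * |(z * starRingEnd ℂ v * w).re| := by
          rw [abs_mul, abs_mul, abs_mul, abs_of_pos (four_pos : (0 : ℝ) < 4), abs_sq]
      _ ≤ 4 * |z.re| * α ^ 2 * (‖z‖ * ‖v‖ * ‖w‖) := by gcongr
      _ = 2 * (|z.re| * α) * (2 * ‖v‖ * (α * ‖z‖ * ‖w‖)) := by ring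
      _ ≤ 2 * (|z.re| * α) * (‖v‖ ^ 2 + (α * ‖z‖ * ‖w‖) ^ 2) := by gcongr
      _ = _ := by ring
  have hsecond : |2 * ‖z‖ ^ 2 * (α * α') * ‖w‖ ^ 2|
      ≤ 2 * γ * (‖v‖ ^ 2 + ‖z‖ ^ 2 * α ^ 2 * ‖w‖ ^ 2) := by
    calc |2 * ‖z‖ ^ 2 * (α * α') * ‖w‖ ^ 2|
        = 2 * ‖z‖ ^ 2 * (α * |α'|) * ‖w‖ ^ 2 := by
          simp only [abs_mul, abs_pow, abs_norm, abs_of_pos hα, abs_two]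
      _ ≤ 2 * ‖z‖ ^ 2 * (α * (γ * α)) * ‖w‖ ^ 2 := by gcongr
      _ = 2 * γ * (‖z‖ ^ 2 * α ^ 2 * ‖w‖ ^ 2) := by ring
      _ ≤ _ := by gcongr; exact le_add_of_nonneg_left (sq_nonneg _)
  linarith [abs_add_le (4 * z.re * α ^ 2 * (z * starRingEnd ℂ v * w).re)
    (2 * ‖z‖ ^ 2 * (α * α') * ‖w‖ ^ 2)]

variable (ha : Differentiable ℝ a) (hpos : ∀ t, 0 < a t)
  (hw : ∀ t, HasDerivAt w (v t) t) (hv : ∀ t, HasDerivAt v (z ^ 2 * (a t ^ 2 : ℝ) * w t) t)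
  {γ s t : ℝ} (hlog : ∀ r ∈ Ioo s t, |deriv a r| ≤ γ * a r) (hst : s ≤ t)

include ha in
theorem hasDerivAt_hillExponent (z : ℂ) (γ s r : ℝ) :
    HasDerivAt (fun r => 2 * (|z.re| * (∫ x in s..r, a x) + γ * r)) (2 * (|z.re| * a r + γ)) r :=
  ((((ha.continuous.integral_hasStrictDerivAt s r).hasDerivAt.const_mul |z.re|).add
    ((hasDerivAt_id r).const_mul γ)).const_mul 2).congr_deriv (by rw [mul_one])

include ha hpos hw hv hlog hst

theorem hillEnergy_le_mul_exp :
    hillEnergy a z w v t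
      ≤ hillEnergy a z w v s * Real.exp (2 * (|z.re| * (∫ x in s..t, a x) + γ * (t - s))) := by
  have := le_mul_exp_sub_of_deriv_le_mul hst (fun r => hasDerivAt_hillEnergy (ha r) (hw r) (hv r))
    (hasDerivAt_hillExponent ha z γ s)
    fun r hr => (abs_le.1 (abs_deriv_hillEnergy_le z (w r) (v r) (hpos r) (hlog r hr))).2
  convert this using 3
  rw [intervalIntegral.integral_same]
  ring

theorem hillEnergy_le_mul_exp_of_le :
    hillEnergy a z w v s
      ≤ hillEnergy a z w v t * Real.exp (2 * (|z.re| * (∫ x in s..t, a x) + γ * (t - s))) := by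
  have := mul_exp_sub_le_of_mul_le_deriv hst
    (fun r => hasDerivAt_hillEnergy (ha r) (hw r) (hv r))
    (fun r => (hasDerivAt_hillExponent ha z γ s r).neg) fun r hr => by
      simpa only [hillEnergy, neg_mul] using
        (abs_le.1 (abs_deriv_hillEnergy_le z (w r) (v r) (hpos r) (hlog r hr))).1
  rw [← div_le_iff₀ (Real.exp_pos _), div_eq_mul_inv, ← Real.exp_neg]
  refine (congrArg (fun e => hillEnergy a z w v s * Real.exp e) ?_).trans_le this
  rw [Pi.neg_apply, Pi.neg_apply, intervalIntegral.integral_same]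
  ring

end HillEnergy

/-- The Hill discriminant of `w'' = z A w`: the trace of its monodromy matrix over `[0, 1]`. -/
noncomputable def hillDiscriminant {𝕜 : Type*} [RCLike 𝕜] (A : ℝ → ℝ) (z : 𝕜) : 𝕜 :=
  odeSol A 0 1 0 z 1 + odeSolDeriv A 0 0 1 z 1

section HillDiscriminant

variable {𝕜 : Type*} [RCLike 𝕜] {a A : ℝ → ℝ}

theorem hillDiscriminant_zero (A : ℝ → ℝ) : hillDiscriminant A (0 : 𝕜) = 2 := by
  rw [hillDiscriminant, odeSol, odeSolDeriv, tsum_eq_single 0, tsum_eq_single 0]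
  · simp only [posTerm, velTerm, pow_zero, mul_one, zero_mul, add_zero, RCLike.ofReal_one]
    exact one_add_one_eq_two
  · intro k hk; simp [hk]
  · intro k hk; simp [hk]

theorem ofReal_hillDiscriminant (A : ℝ → ℝ) (z : ℝ) :
    ((hillDiscriminant A z : ℝ) : 𝕜) = hillDiscriminant A (z : 𝕜) := by
  simp [hillDiscriminant, ofReal_odeSol, ofReal_odeSolDeriv]

theorem differentiable_hillDiscriminant (hA : Continuous A) :
    Differentiable ℂ fun z : ℂ => hillDiscriminant A z :=
  (differentiable_odeSol_param hA 1).add (differentiable_odeSolDeriv_param hA 1)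

theorem norm_hillDiscriminant_sq_le (ha : Differentiable ℝ a) (hpos : ∀ t, 0 < a t) {γ : ℝ}
    (hlog : ∀ t ∈ Ioo 0 1, |deriv a t| ≤ γ * a t) (hper : a 0 = a 1) {z : ℂ} (hz : 0 ≤ z.re) :
    ‖hillDiscriminant (fun t => a t ^ 2) (z ^ 2)‖
      ≤ 2 * (Real.exp γ * Real.exp (z.re * ∫ s in (0 : ℝ)..1, a s)) := by
  have hγ : 0 ≤ γ := nonneg_of_mul_nonneg_left
    ((abs_nonneg _).trans (hlog (1 / 2) ⟨by norm_num, by norm_num⟩)) (hpos _)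
  rw [← Real.exp_add]
  rcases eq_or_ne z 0 with rfl | hz0
  · simp [hillDiscriminant_zero, hγ]
  set R := Real.exp (γ + z.re * ∫ s in (0 : ℝ)..1, a s) with hR
  have hgrow : ∀ x y : ℝ, ‖odeSolDeriv (fun t => a t ^ 2) 0 x y (z ^ 2) 1‖ ^ 2
      + ‖z‖ ^ 2 * a 1 ^ 2 * ‖odeSol (fun t => a t ^ 2) 0 x y (z ^ 2) 1‖ ^ 2
      ≤ (‖(y : ℂ)‖ ^ 2 + ‖z‖ ^ 2 * a 1 ^ 2 * ‖(x : ℂ)‖ ^ 2) * R ^ 2 := fun x y => by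
    have := hillEnergy_le_mul_exp ha hpos (fun t => hasDerivAt_odeSol (ha.continuous.pow 2) _ t)
      (fun t => hasDerivAt_odeSolDeriv (t₀ := 0) (x := x) (y := y) (ha.continuous.pow 2) (z ^ 2) t)
      hlog zero_le_one
    rw [hillEnergy, hillEnergy, odeSol_self, odeSolDeriv_self, hper, abs_of_nonneg hz] at this
    refine this.trans_eq ?_
    rw [hR, ← Real.exp_nat_mul]
    congr 2
    push_cast
    ring
  have hpos_le : ‖odeSol (fun t => a t ^ 2) 0 1 0 (z ^ 2) 1‖ ≤ R := by
    have hcoef : 0 < ‖z‖ ^ 2 * a 1 ^ 2 := by have := hpos 1; positivity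
    have h := (le_add_of_nonneg_left (sq_nonneg _)).trans (hgrow 1 0)
    simp only [Complex.ofReal_zero, Complex.ofReal_one, norm_zero, norm_one, one_pow, mul_one,
      zero_pow two_ne_zero, zero_add] at h
    exact (sq_le_sq₀ (norm_nonneg _) (Real.exp_pos _).le).1 (le_of_mul_le_mul_left h hcoef)
  have hvel_le : ‖odeSolDeriv (fun t => a t ^ 2) 0 0 1 (z ^ 2) 1‖ ≤ R := by
    have h := (le_add_of_nonneg_right (by positivity)).trans (hgrow 0 1)
    simp only [Complex.ofReal_zero, Complex.ofReal_one, norm_zero, norm_one, one_pow, mul_zero,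
      zero_pow two_ne_zero, add_zero, one_mul] at h
    exact (sq_le_sq₀ (norm_nonneg _) (Real.exp_pos _).le).1 h
  exact (norm_add_le _ _).trans (by linarith)

theorem posTerm_nonneg_and_velTerm_nonneg (hA : ∀ t, 0 ≤ A t) {x y : ℝ} (hx : 0 ≤ x)
    (hy : 0 ≤ y) (k : ℕ) {t : ℝ} (ht : 0 ≤ t) :
    0 ≤ posTerm A 0 x y k t ∧ 0 ≤ velTerm A 0 x y k t := by
  induction k generalizing t with
  | zero => exact ⟨add_nonneg hx (mul_nonneg hy (by rwa [sub_zero])), hy⟩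
  | succ k ih =>
    have hvel : ∀ s, 0 ≤ s → 0 ≤ ∫ r in (0 : ℝ)..s, A r * posTerm A 0 x y k r := fun s hs =>
      intervalIntegral.integral_nonneg hs fun r hr => mul_nonneg (hA r) (ih hr.1).1
    exact ⟨intervalIntegral.integral_nonneg ht fun r hr => hvel r hr.1, hvel t ht⟩

theorem integral_primitive_add_integral_mul_id (hA : Continuous A) :
    (∫ s in (0 : ℝ)..1, ∫ r in (0 : ℝ)..s, A r) + ∫ r in (0 : ℝ)..1, A r * r
      = ∫ s in (0 : ℝ)..1, A s := by
  have hprim : Continuous fun s => ∫ r in (0 : ℝ)..s, A r :=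
    intervalIntegral.continuous_primitive hA.intervalIntegrable 0
  have hparts := intervalIntegral.integral_eq_sub_of_hasDerivAt (a := 0) (b := 1)
    (fun t _ => (hasDerivAt_id t).mul (hA.integral_hasStrictDerivAt 0 t).hasDerivAt)
    (Continuous.intervalIntegrable (by fun_prop) 0 1)
  simp only [id, Pi.mul_apply, one_mul, zero_mul, sub_zero] at hparts
  rw [← hparts, ← intervalIntegral.integral_add (hprim.intervalIntegrable 0 1)
    (Continuous.intervalIntegrable (by fun_prop) 0 1)]
  simp only [mul_comm]

theorem two_add_mul_integral_le_hillDiscriminant (hA : Continuous A) (hA0 : ∀ t, 0 ≤ A t) {ζ : ℝ}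
    (hζ : 0 ≤ ζ) : 2 + ζ * ∫ s in (0 : ℝ)..1, A s ≤ hillDiscriminant A ζ := by
  have hpos := sum_le_hasSum (Finset.range 2) (fun k _ => mul_nonneg
    (posTerm_nonneg_and_velTerm_nonneg hA0 zero_le_one le_rfl k zero_le_one).1 (pow_nonneg hζ k))
    (hasSum_odeSol hA ζ 1)
  have hvel := sum_le_hasSum (Finset.range 2) (fun k _ => mul_nonneg
    (posTerm_nonneg_and_velTerm_nonneg hA0 le_rfl zero_le_one k zero_le_one).2 (pow_nonneg hζ k))
    (hasSum_odeSolDeriv hA ζ 1)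
  simp only [Finset.sum_range_succ, Finset.sum_range_zero, posTerm, velTerm, pow_zero, pow_one,
    mul_one, zero_mul, add_zero, zero_add, sub_zero, one_mul] at hpos hvel
  rw [← integral_primitive_add_integral_mul_id hA]
  refine le_trans (le_of_eq ?_) (add_le_add hpos hvel)
  ring

end HillDiscriminant

theorem norm_chebyshev_T_eval_le {B : ℝ} (hB : 1 ≤ B) {w : ℂ} (hw : ‖w‖ ≤ B) (n : ℕ) :
    ‖(Polynomial.Chebyshev.T ℂ n).eval w‖ ≤ (3 * B) ^ n := by
  induction n using Nat.twoStepInduction with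
  | zero => simp
  | one => simpa using by linarith
  | more n ih ih_succ =>
    have hrec : (Polynomial.Chebyshev.T ℂ ((n + 1 + 1 : ℕ) : ℤ)).eval w =
        2 * w * (Polynomial.Chebyshev.T ℂ ((n + 1 : ℕ) : ℤ)).eval w -
          (Polynomial.Chebyshev.T ℂ ((n : ℕ) : ℤ)).eval w := by
      have := Polynomial.Chebyshev.T_add_two ℂ (n : ℤ)
      push_cast
      rw [add_assoc, one_add_one_eq_two, this]
      simp
    have hlead : ‖2 * w * (Polynomial.Chebyshev.T ℂ ((n + 1 : ℕ) : ℤ)).eval w‖ ≤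
        2 * B * (3 * B) ^ (n + 1) := by
      rw [norm_mul, norm_mul, Complex.norm_ofNat]
      gcongr
    have hlower : (3 * B) ^ n ≤ B * (3 * B) ^ (n + 1) := by
      have : (1 : ℝ) ≤ B * (3 * B) := one_le_mul_of_one_le_of_one_le hB (by linarith)
      calc (3 * B) ^ n ≤ B * (3 * B) * (3 * B) ^ n := le_mul_of_one_le_left (by positivity) this
        _ = _ := by ring
    calc _ ≤ 2 * B * (3 * B) ^ (n + 1) + (3 * B) ^ n := by
          rw [hrec]; exact (norm_sub_le _ _).trans (add_le_add hlead ih)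
      _ ≤ 2 * B * (3 * B) ^ (n + 1) + B * (3 * B) ^ (n + 1) := by gcongr
      _ = _ := by ring

theorem norm_le_exp_of_norm_le_one_on_imaginary_axis {G : ℂ → ℂ} (hG : Differentiable ℂ G)
    {B M : ℝ} (hgrow : ∀ z : ℂ, 0 ≤ z.re → ‖G z‖ ≤ B * Real.exp (z.re * M))
    (himag : ∀ x : ℝ, ‖G (x * Complex.I)‖ ≤ 1) {z : ℂ} (hz : 0 ≤ z.re) :
    ‖G z‖ ≤ Real.exp (z.re * M) := by
  set g : ℂ → ℂ := fun z => G z * Complex.exp (-(z * M)) with hg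
  have hnorm : ∀ z, ‖g z‖ = ‖G z‖ * Real.exp (-(z.re * M)) := fun z => by
    rw [hg, norm_mul, Complex.norm_exp, Complex.neg_re, Complex.re_mul_ofReal]
  have hbound : ∀ z : ℂ, 0 ≤ z.re → ‖g z‖ ≤ B := fun z hz => by
    rw [hnorm, Real.exp_neg, ← div_eq_mul_inv, div_le_iff₀ (Real.exp_pos _)]
    exact hgrow z hz
  have hle_one : ‖g z‖ ≤ 1 := by
    refine PhragmenLindelof.right_half_plane_of_bounded_on_real
      (Differentiable.diffContOnCl (by fun_prop)) ⟨1, by norm_num, 0, ?_⟩ ?_ (fun x => ?_) hz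
    · refine Asymptotics.IsBigO.of_bound B (eventually_inf_principal.2 (.of_forall fun z hz => ?_))
      simpa using hbound z (le_of_lt hz)
    · refine isBoundedUnder_of_eventually_le (a := B) ?_
      filter_upwards [eventually_ge_atTop 0] with x hx using hbound x (by simpa using hx)
    · rw [hnorm]
      simpa using himag x
  rwa [hnorm, Real.exp_neg, ← div_eq_mul_inv, div_le_one (Real.exp_pos _)] at hle_one

theorem le_of_forall_cosh_natCast_mul_le_exp {θ s : ℝ}
    (h : ∀ n : ℕ, Real.cosh (n * θ) ≤ Real.exp (n * s)) : θ ≤ s := by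
  by_contra! hlt
  obtain ⟨n, hn⟩ := exists_nat_gt (Real.log 2 / (θ - s))
  rw [div_lt_iff₀ (sub_pos.2 hlt)] at hn
  have hexp_le : Real.exp (n * θ) ≤ 2 * Real.exp (n * s) := by
    have := h n
    rw [Real.cosh_eq] at this
    linarith [Real.exp_pos (-(n * θ))]
  have hexp_gt : Real.exp (Real.log 2 + n * s) < Real.exp (n * θ) :=
    Real.exp_lt_exp.2 (by linarith)
  rw [Real.exp_add, Real.exp_log two_pos] at hexp_gt
  linarith

/-- The Chebyshev polynomials turn the bound `2` into the optimal type: `T_n (F (z²) / 2)` is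
bounded by `1` on the imaginary axis and has type `n L`, while `T_n (cosh θ) = cosh (n θ)`, so the
constant `K` disappears as `n → ∞`. -/
theorem le_two_cosh_of_abs_le_two {F : ℂ → ℂ} {f : ℝ → ℝ} (hF : Differentiable ℂ F)
    (hFf : ∀ x : ℝ, F x = f x) {K L : ℝ} (hK : 1 ≤ K) (hL : 0 ≤ L)
    (hgrow : ∀ z : ℂ, 0 ≤ z.re → ‖F (z ^ 2)‖ ≤ 2 * (K * Real.exp (z.re * L)))
    (hbound : ∀ x : ℝ, |f (-x ^ 2)| ≤ 2) {y : ℝ} (hy : 0 ≤ y) :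
    f (y ^ 2) ≤ 2 * Real.cosh (y * L) := by
  rcases le_total (f (y ^ 2)) 2 with hle | hge
  · linarith [Real.one_le_cosh (y * L)]
  obtain ⟨θ, hθ0, hθ⟩ : ∃ θ, 0 ≤ θ ∧ Real.cosh θ = f (y ^ 2) / 2 :=
    ⟨_, Real.arcosh_nonneg (by linarith), Real.cosh_arcosh (by linarith)⟩
  have hhalf : ∀ (n : ℕ) (x : ℝ), (Polynomial.Chebyshev.T ℂ n).eval (F x / 2)
      = ((Polynomial.Chebyshev.T ℝ n).eval (f x / 2) : ℝ) := fun n x => by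
    rw [hFf, Polynomial.Chebyshev.complex_ofReal_eval_T, Complex.ofReal_div, Complex.ofReal_ofNat]
  have hθL : θ ≤ y * L := le_of_forall_cosh_natCast_mul_le_exp fun n => by
    have hPL := norm_le_exp_of_norm_le_one_on_imaginary_axis (z := y) (B := (3 * K) ^ n)
      (M := n * L) (G := fun z => (Polynomial.Chebyshev.T ℂ n).eval (F (z ^ 2) / 2))
      ((Polynomial.differentiable (Polynomial.Chebyshev.T ℂ n)).comp (by fun_prop))
      (fun z hz => ?_) (fun x => ?_) (by simpa using hy)
    · rw [← Complex.ofReal_pow, hhalf, Complex.norm_real, ← hθ] at hPL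
      have hT := Polynomial.Chebyshev.T_real_cosh θ n
      rw [hT, Real.norm_of_nonneg (Real.cosh_pos _).le, Complex.ofReal_re] at hPL
      simpa only [Int.cast_natCast, mul_left_comm] using hPL
    · have hbase : 1 ≤ K * Real.exp (z.re * L) := one_le_mul_of_one_le_of_one_le hK
        (Real.one_le_exp (mul_nonneg hz hL))
      refine (norm_chebyshev_T_eval_le hbase ?_ n).trans_eq ?_
      · rw [norm_div, Complex.norm_ofNat]
        linarith [hgrow z hz]
      · rw [← mul_assoc, mul_pow, ← Real.exp_nat_mul, mul_left_comm]
    · rw [mul_pow, Complex.I_sq, mul_neg_one, ← Complex.ofReal_pow, ← Complex.ofReal_neg, hhalf,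
        Complex.norm_real]
      refine Polynomial.Chebyshev.abs_eval_T_real_le_one n ?_
      rw [abs_div, abs_two]
      linarith [hbound x]
  have := Real.cosh_le_cosh.2 (abs_le_abs_of_nonneg hθ0 hθL)
  linarith

theorem le_sq_of_forall_two_add_sq_mul_le_two_cosh {J L : ℝ}
    (h : ∀ y : ℝ, 0 < y → 2 + y ^ 2 * J ≤ 2 * Real.cosh (y * L)) : J ≤ L ^ 2 := by
  have hderiv : HasDerivAt (fun u => 2 * Real.exp (u * (L ^ 2 / 2))) (L ^ 2) 0 :=
    ((((hasDerivAt_id (0 : ℝ)).mul_const (L ^ 2 / 2)).exp).const_mul 2).congr_deriv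
      (by simp; ring)
  refine ge_of_tendsto hderiv.tendsto_slope_zero_right ?_
  filter_upwards [self_mem_nhdsWithin] with u (hu : 0 < u)
  have hcosh := Real.cosh_le_exp_half_sq (√u * L)
  have hu_le := h √u (Real.sqrt_pos.2 hu)
  rw [mul_pow, Real.sq_sqrt hu.le, mul_div_assoc] at hcosh
  rw [Real.sq_sqrt hu.le] at hu_le
  simp only [zero_add, zero_mul, Real.exp_zero, mul_one, smul_eq_mul]
  rw [← div_eq_inv_mul, le_div_iff₀ hu]
  linarith

theorem eq_integral_of_integral_sq_le_sq {a : ℝ → ℝ} (ha : Continuous a)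
    (hle : ∫ s in (0 : ℝ)..1, a s ^ 2 ≤ (∫ s in (0 : ℝ)..1, a s) ^ 2) {t : ℝ}
    (ht : t ∈ Icc (0 : ℝ) 1) : a t = ∫ s in (0 : ℝ)..1, a s := by
  set L := ∫ s in (0 : ℝ)..1, a s with hL
  have hvariance : ∫ s in (0 : ℝ)..1, (a s - L) ^ 2 = (∫ s in (0 : ℝ)..1, a s ^ 2) - L ^ 2 := by
    simp only [sub_sq]
    rw [intervalIntegral.integral_add (Continuous.intervalIntegrable (by fun_prop) _ _)
      (Continuous.intervalIntegrable (by fun_prop) _ _),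
      intervalIntegral.integral_sub (Continuous.intervalIntegrable (by fun_prop) _ _)
      (Continuous.intervalIntegrable (by fun_prop) _ _), intervalIntegral.integral_mul_const,
      intervalIntegral.integral_const_mul, intervalIntegral.integral_const, ← hL]
    simp only [sub_zero, one_smul]
    ring
  by_contra hne
  have : 0 < ∫ s in (0 : ℝ)..1, (a s - L) ^ 2 :=
    intervalIntegral.integral_pos zero_lt_one (Continuous.continuousOn (by fun_prop))
      (fun s _ => sq_nonneg _) ⟨t, ht, by have := sub_ne_zero.2 hne; positivity⟩
  linarith

theorem exists_abs_deriv_le_mul {a : ℝ → ℝ} (ha : ContDiff ℝ 1 a) (hpos : ∀ t, 0 < a t)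
    (s t : ℝ) : ∃ γ, 0 ≤ γ ∧ ∀ r ∈ Icc s t, |deriv a r| ≤ γ * a r := by
  obtain ⟨γ, hγ⟩ := (isCompact_Icc (a := s) (b := t)).exists_bound_of_continuousOn
    (((ha.continuous_deriv le_rfl).div ha.continuous fun r => (hpos r).ne').continuousOn)
  refine ⟨max γ 0, le_max_right _ _, fun r hr => ?_⟩
  have := (hγ r hr).trans (le_max_left γ 0)
  rwa [Real.norm_eq_abs, Pi.div_apply, abs_div, abs_of_pos (hpos r), div_le_iff₀ (hpos r)] at this

theorem exists_two_lt_abs_hillDiscriminant {a : ℝ → ℝ} (ha : ContDiff ℝ 1 a)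
    (hpos : ∀ t, 0 < a t) (hper : a 0 = a 1) (hne : ∃ t ∈ Icc (0 : ℝ) 1, a t ≠ a 0) :
    ∃ l : ℝ, 0 < l ∧ 2 < |hillDiscriminant (fun t => a t ^ 2) (-l ^ 2)| := by
  by_contra! hcon
  obtain ⟨γ, hγ0, hγ⟩ := exists_abs_deriv_le_mul ha hpos 0 1
  have hA : Continuous fun t => a t ^ 2 := ha.continuous.pow 2
  have hL : 0 ≤ ∫ s in (0 : ℝ)..1, a s :=
    intervalIntegral.integral_nonneg zero_le_one fun s _ => (hpos s).le
  have hbound : ∀ x : ℝ, |hillDiscriminant (fun t => a t ^ 2) (-x ^ 2)| ≤ 2 := fun x => by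
    rcases eq_or_ne x 0 with rfl | hx
    · simp [hillDiscriminant_zero]
    · simpa only [sq_abs] using hcon |x| (abs_pos.2 hx)
  have hcosh : ∀ y : ℝ, 0 < y → 2 + y ^ 2 * ∫ s in (0 : ℝ)..1, a s ^ 2
      ≤ 2 * Real.cosh (y * ∫ s in (0 : ℝ)..1, a s) := fun y hy =>
    (two_add_mul_integral_le_hillDiscriminant hA (fun t => sq_nonneg (a t)) (sq_nonneg y)).trans
      (le_two_cosh_of_abs_le_two (differentiable_hillDiscriminant hA)
        (fun x => (ofReal_hillDiscriminant _ x).symm) (Real.one_le_exp hγ0) hL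
        (fun z hz => norm_hillDiscriminant_sq_le (ha.differentiable one_ne_zero) hpos
          (fun t ht => hγ t (Ioo_subset_Icc_self ht)) hper hz) hbound hy.le)
  have hconst : ∀ t ∈ Icc (0 : ℝ) 1, a t = ∫ s in (0 : ℝ)..1, a s := fun t =>
    eq_integral_of_integral_sq_le_sq ha.continuous
      (le_sq_of_forall_two_add_sq_mul_le_two_cosh hcosh)
  obtain ⟨t, ht, hne⟩ := hne
  exact hne (by rw [hconst t ht, hconst 0 (by simp)])

/-! ### Resonance of the monodromy matrix -/

open Matrix in
/-- The monodromy matrix over `[0, 1]` of `w'' = z A w`, acting on the states `![w, w']`. -/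
noncomputable def monodromy (A : ℝ → ℝ) (z : ℝ) : Matrix (Fin 2) (Fin 2) ℝ :=
  !![odeSol A 0 1 0 z 1, odeSol A 0 0 1 z 1; odeSolDeriv A 0 1 0 z 1, odeSolDeriv A 0 0 1 z 1]

section Monodromy

open Matrix

variable {A : ℝ → ℝ}

theorem odeSol_eq_linear (hA : Continuous A) (x y z : ℝ) {t : ℝ} (ht : 0 ≤ t) :
    odeSol A 0 x y z t = x * odeSol A 0 1 0 z t + y * odeSol A 0 0 1 z t ∧
    odeSolDeriv A 0 x y z t = x * odeSolDeriv A 0 1 0 z t + y * odeSolDeriv A 0 0 1 z t := by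
  have hpos : ∀ x y s, HasDerivAt (odeSol A 0 x y z) (odeSolDeriv A 0 x y z s) s := fun x y s =>
    hasDerivAt_odeSol hA z s
  have hvel : ∀ x y s, HasDerivAt (odeSolDeriv A 0 x y z) ((z * A s) • odeSol A 0 x y z s) s :=
    fun x y s => hasDerivAt_odeSolDeriv hA z s
  refine secondOrderODE_solution_unique (by fun_prop)
    (fun s _ => (hpos x y s).hasDerivWithinAt) (fun s _ => (hvel x y s).hasDerivWithinAt)
    (fun s _ => (((hpos 1 0 s).const_mul x).add ((hpos 0 1 s).const_mul y)).hasDerivWithinAt)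
    (fun s _ => ((((hvel 1 0 s).const_mul x).add
      ((hvel 0 1 s).const_mul y)).congr_deriv ?_).hasDerivWithinAt) ?_ ?_ t ⟨ht, le_rfl⟩
  · simp only [Pi.add_apply, smul_eq_mul]
    ring
  · simp
  · simp

theorem monodromy_mulVec (hA : Continuous A) (x y z : ℝ) :
    monodromy A z *ᵥ ![x, y] = ![odeSol A 0 x y z 1, odeSolDeriv A 0 x y z 1] := by
  obtain ⟨hpos, hvel⟩ := odeSol_eq_linear hA x y z zero_le_one
  ext i
  fin_cases i <;> simp [monodromy, hpos, hvel, vecHead, vecTail]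

/-- The determinant is the Wronskian, which is constant because the equation has no first-order
term. -/
theorem det_monodromy (hA : Continuous A) (z : ℝ) : (monodromy A z).det = 1 := by
  have hwronskian : ∀ s, HasDerivAt (odeSol A 0 1 0 z * odeSolDeriv A 0 0 1 z -
      odeSol A 0 0 1 z * odeSolDeriv A 0 1 0 z) 0 s := fun s =>
    (((hasDerivAt_odeSol hA z s).mul (hasDerivAt_odeSolDeriv hA z s)).sub
      ((hasDerivAt_odeSol hA z s).mul (hasDerivAt_odeSolDeriv hA z s))).congr_deriv
      (by simp only [RCLike.ofReal_real_eq_id, id]; ring)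
  have hconst := is_const_of_deriv_eq_zero (fun s => (hwronskian s).differentiableAt)
    (fun s => (hwronskian s).deriv) 1 0
  rw [monodromy, det_fin_two_of]
  simpa using hconst

theorem trace_monodromy (A : ℝ → ℝ) (z : ℝ) : (monodromy A z).trace = hillDiscriminant A z := by
  rw [monodromy, trace_fin_two_of, hillDiscriminant]

theorem continuous_monodromy (hA : Continuous A) : Continuous (monodromy A) := by
  refine continuous_matrix fun i j => ?_
  fin_cases i <;> fin_cases j
  exacts [continuous_odeSol_param hA 1, continuous_odeSol_param hA 1,
    continuous_odeSolDeriv_param hA 1, continuous_odeSolDeriv_param hA 1]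

end Monodromy

/-- Twice the energy of the harmonic oscillator `w'' = -ρ² w` in the state `w = x`, `w' = y`. -/
def oscillatorEnergy (ρ x y : ℝ) : ℝ := ρ ^ 2 * x ^ 2 + y ^ 2

theorem oscillatorEnergy_pos {ρ x y : ℝ} (hρ : ρ ≠ 0) (hxy : x ≠ 0 ∨ y ≠ 0) :
    0 < oscillatorEnergy ρ x y := by
  unfold oscillatorEnergy
  rcases hxy with h | h <;> positivity

theorem oscillatorEnergy_eq_norm_sq (ρ x y : ℝ) :
    oscillatorEnergy ρ x y = ‖(⟨ρ * x, y⟩ : ℂ)‖ ^ 2 := by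
  rw [← Complex.normSq_eq_norm_sq, Complex.normSq_apply, oscillatorEnergy]
  ring

theorem oscillatorEnergy_mul (r ρ x y : ℝ) :
    oscillatorEnergy ρ (r * x) (r * y) = r ^ 2 * oscillatorEnergy ρ x y := by
  unfold oscillatorEnergy; ring

section Resonance

open Matrix

theorem pow_mul_norm_le_of_recurrence {E : Type*} [SeminormedAddCommGroup E] [NormedSpace ℝ E]
    {X : ℕ → E} {D g : ℝ} (hg : 1 ≤ g) (hD : g + g⁻¹ ≤ |D|)
    (hrec : ∀ j, X (j + 2) = D • X (j + 1) - X j) (hstart : g * ‖X 0‖ ≤ ‖X 1‖) (n : ℕ) :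
    g ^ n * ‖X 0‖ ≤ ‖X n‖ := by
  have hg0 : 0 < g := zero_lt_one.trans_le hg
  have hstep : ∀ j, g * ‖X j‖ ≤ ‖X (j + 1)‖ := fun j => by
    induction j with
    | zero => exact hstart
    | succ j ih =>
      calc g * ‖X (j + 1)‖ = (g + g⁻¹) * ‖X (j + 1)‖ - g⁻¹ * ‖X (j + 1)‖ := by ring
        _ ≤ |D| * ‖X (j + 1)‖ - ‖X j‖ :=
          sub_le_sub (by gcongr) (by rwa [inv_mul_eq_div, le_div_iff₀' hg0])
        _ = ‖D • X (j + 1)‖ - ‖X j‖ := by rw [norm_smul, Real.norm_eq_abs]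
        _ ≤ ‖X (j + 1 + 1)‖ := by rw [hrec j]; exact norm_sub_norm_le _ _
  induction n with
  | zero => simp
  | succ n ih =>
    calc g ^ (n + 1) * ‖X 0‖ = g * (g ^ n * ‖X 0‖) := by ring
      _ ≤ g * ‖X n‖ := by gcongr
      _ ≤ ‖X (n + 1)‖ := hstep n

theorem mulVec_mulVec_eq_of_det_eq_one {R : Type*} [CommRing R] {M : Matrix (Fin 2) (Fin 2) R}
    (hM : M.det = 1) (p : Fin 2 → R) : M *ᵥ (M *ᵥ p) = M.trace • (M *ᵥ p) - p := by
  have hcayley : M * M = M.trace • M - 1 := by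
    nontriviality R
    have hchar := M.aeval_self_charpoly
    rw [charpoly_fin_two, hM] at hchar
    simp only [map_add, map_sub, map_mul, map_pow, Polynomial.aeval_X, Polynomial.aeval_C,
      map_one, ← Algebra.smul_def] at hchar
    rw [← sq, ← sub_eq_zero, ← hchar]
    abel
  rw [mulVec_mulVec, hcayley, sub_mulVec, smul_mulVec, one_mulVec]

theorem pow_mul_oscillatorEnergy_le {M : Matrix (Fin 2) (Fin 2) ℝ} (hM : M.det = 1) {g ρ : ℝ}
    (hg : 1 ≤ g) (htrace : g + g⁻¹ ≤ |M.trace|) {e : Fin 2 → ℝ}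
    (hstart : g ^ 2 * oscillatorEnergy ρ (e 0) (e 1)
      ≤ oscillatorEnergy ρ ((M *ᵥ e) 0) ((M *ᵥ e) 1)) (n : ℕ) :
    (g ^ 2) ^ n * oscillatorEnergy ρ (e 0) (e 1)
      ≤ oscillatorEnergy ρ ((M ^ n *ᵥ e) 0) ((M ^ n *ᵥ e) 1) := by
  set X : ℕ → ℂ := fun j => ⟨ρ * (M ^ j *ᵥ e) 0, (M ^ j *ᵥ e) 1⟩ with hX
  have hrec : ∀ j, X (j + 2) = M.trace • X (j + 1) - X j := fun j => by
    have hcayley := mulVec_mulVec_eq_of_det_eq_one hM (M ^ j *ᵥ e)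
    simp only [mulVec_mulVec, ← pow_succ'] at hcayley
    simp only [hX, pow_succ' M (j + 1), pow_succ' M j] at hcayley ⊢
    apply Complex.ext <;> simp [hcayley]
    ring
  have hstart' : g * ‖X 0‖ ≤ ‖X 1‖ := by
    refine (sq_le_sq₀ (by positivity) (norm_nonneg _)).1 ?_
    simpa only [hX, mul_pow, ← oscillatorEnergy_eq_norm_sq, pow_zero, pow_one, one_mulVec]
      using hstart
  have hgrow := pow_le_pow_left₀ (by positivity)
    (pow_mul_norm_le_of_recurrence hg htrace hrec hstart' n) 2
  simpa only [hX, mul_pow, ← oscillatorEnergy_eq_norm_sq, pow_zero, one_mulVec, ← pow_mul,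
    mul_comm n 2] using hgrow

theorem exists_add_inv_eq_of_two_lt_abs {D : ℝ} (hD : 2 < |D|) :
    ∃ μ : ℝ, 1 < |μ| ∧ μ + μ⁻¹ = D ∧ |μ| + |μ|⁻¹ = |D| := by
  set θ := Real.arcosh (|D| / 2)
  have hθ : Real.exp θ + (Real.exp θ)⁻¹ = |D| := by
    have := Real.cosh_arcosh (x := |D| / 2) (by linarith)
    rw [Real.cosh_eq, Real.exp_neg] at this
    linarith
  have hexp : 1 < Real.exp θ := Real.one_lt_exp_iff.2 (Real.arcosh_pos (by linarith))
  rcases abs_choice D with h | h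
  · exact ⟨Real.exp θ, by rwa [Real.abs_exp], hθ.trans h, by rwa [Real.abs_exp]⟩
  · refine ⟨-Real.exp θ, by rwa [abs_neg, Real.abs_exp], ?_, by rwa [abs_neg, Real.abs_exp]⟩
    rw [inv_neg, ← neg_add, hθ, h, neg_neg]

theorem add_inv_lt_add_inv {g m : ℝ} (hg : 1 < g) (hgm : g < m) : g + g⁻¹ < m + m⁻¹ := by
  have hm : 1 < m := hg.trans hgm
  have hdiff : m + m⁻¹ - (g + g⁻¹) = (m - g) * (1 - (m * g)⁻¹) := by field_simp; ring
  have hfactor : (m * g)⁻¹ < 1 := inv_lt_one_of_one_lt₀ (one_lt_mul_of_lt_of_le hm hg.le)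
  linarith [mul_pos (sub_pos.2 hgm) (sub_pos.2 hfactor)]

theorem exists_mulVec_eq_smul_of_trace_eq {M : Matrix (Fin 2) (Fin 2) ℝ} (hM : M.det = 1) {μ : ℝ}
    (hμ : μ ≠ 0) (htrace : μ + μ⁻¹ = M.trace) : ∃ e : Fin 2 → ℝ, e ≠ 0 ∧ M *ᵥ e = μ • e := by
  have hdet : (M - μ • 1).det = 0 := by
    rw [trace_fin_two] at htrace
    rw [det_fin_two] at hM
    have hquad : μ ^ 2 + 1 = (M 0 0 + M 1 1) * μ := by rw [← htrace]; field_simp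
    rw [det_fin_two]
    simp only [Matrix.sub_apply, Matrix.smul_apply, Matrix.one_apply, smul_eq_mul, Fin.isValue,
      ↓reduceIte, zero_ne_one, one_ne_zero, mul_one, mul_zero, sub_zero]
    linear_combination hM + hquad
  obtain ⟨e, he, hMe⟩ := exists_mulVec_eq_zero_iff.2 hdet
  exact ⟨e, he, by rwa [sub_mulVec, smul_mulVec, one_mulVec, sub_eq_zero] at hMe⟩

theorem exists_exp_mul_oscillatorEnergy_le {M : ℝ → Matrix (Fin 2) (Fin 2) ℝ} (hM : Continuous M)
    (hdet : ∀ l, (M l).det = 1) {l₀ : ℝ} (hl₀ : l₀ ≠ 0) (htrace : 2 < |(M l₀).trace|) :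
    ∃ κ : ℝ, 0 < κ ∧ ∃ e : Fin 2 → ℝ, e ≠ 0 ∧ ∀ᶠ l in 𝓝 l₀, ∀ n : ℕ,
      Real.exp (2 * κ * n) * oscillatorEnergy l (e 0) (e 1)
        ≤ oscillatorEnergy l ((M l ^ n *ᵥ e) 0) ((M l ^ n *ᵥ e) 1) := by
  obtain ⟨μ, hμ, hμ_add_inv, hμ_abs⟩ := exists_add_inv_eq_of_two_lt_abs htrace
  obtain ⟨e, he, hMe⟩ := exists_mulVec_eq_smul_of_trace_eq (hdet l₀)
    (abs_pos.1 (zero_lt_one.trans hμ)) hμ_add_inv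
  obtain ⟨g, hg, hgμ⟩ := exists_between hμ
  have hg0 : 0 < g := zero_lt_one.trans hg
  have he' : e 0 ≠ 0 ∨ e 1 ≠ 0 := by
    contrapose! he
    exact funext fun i => by fin_cases i; exacts [he.1, he.2]
  have hstart : g ^ 2 * oscillatorEnergy l₀ (e 0) (e 1)
      < oscillatorEnergy l₀ ((M l₀ *ᵥ e) 0) ((M l₀ *ᵥ e) 1) := by
    rw [hMe, Pi.smul_apply, Pi.smul_apply, smul_eq_mul, smul_eq_mul, oscillatorEnergy_mul,
      ← sq_abs μ]
    have := oscillatorEnergy_pos hl₀ he'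
    gcongr
  have hstart_near : ∀ᶠ l in 𝓝 l₀, g ^ 2 * oscillatorEnergy l (e 0) (e 1)
      < oscillatorEnergy l ((M l *ᵥ e) 0) ((M l *ᵥ e) 1) := by
    have : ∀ i, Continuous fun l => (M l *ᵥ e) i := fun i =>
      (continuous_apply i).comp (hM.matrix_mulVec continuous_const)
    unfold oscillatorEnergy at hstart ⊢
    exact ContinuousAt.eventually_lt (by fun_prop) (by fun_prop) hstart
  have htrace_near : ∀ᶠ l in 𝓝 l₀, g + g⁻¹ < |(M l).trace| :=
    hM.matrix_trace.abs.continuousAt.eventually_const_lt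
      ((add_inv_lt_add_inv hg hgμ).trans_eq hμ_abs)
  refine ⟨Real.log g, Real.log_pos hg, e, he, ?_⟩
  filter_upwards [hstart_near, htrace_near] with l hstart_l htrace_l n
  have hexp : Real.exp (2 * Real.log g * n) = (g ^ 2) ^ n := by
    rw [mul_comm, Real.exp_nat_mul, ← Nat.cast_two, Real.exp_nat_mul, Real.exp_log hg0]
  rw [hexp]
  exact pow_mul_oscillatorEnergy_le (hdet l) hg.le htrace_l.le hstart_l.le n

end Resonance

/-! ### Series of Schwartz functions -/

section DifferenceQuotient

theorem hasDerivWithinAt_iff_tendsto_inv_smul {F : Type*} [AddCommGroup F] [Module ℝ F]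
    [TopologicalSpace F] [ContinuousSMul ℝ F] {f : ℝ → F} {f' : F} {s : Set ℝ} {t : ℝ} :
    HasDerivWithinAt f f' s t ↔
      Tendsto (fun y => (y - t)⁻¹ • (f y - f t - (y - t) • f')) (𝓝[s] t) (𝓝 0) := by
  rw [hasDerivWithinAt_iff_hasFDerivWithinAt, hasFDerivWithinAt_iff_isLittleOTVS,
    Asymptotics.isLittleOTVS_iff_tendsto_inv_smul]
  · simp
  · refine Filter.Eventually.of_forall fun y hy => ?_
    rw [sub_eq_zero] at hy
    simp [hy]

theorem hasDerivWithinAt_continuousLinearMap_apply {F G : Type*} [AddCommGroup F] [Module ℝ F]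
    [TopologicalSpace F] [ContinuousSMul ℝ F] [AddCommGroup G] [Module ℝ G]
    [TopologicalSpace G] [ContinuousSMul ℝ G] (L : F →L[ℝ] G) {f : ℝ → F} {f' : F} {s : Set ℝ}
    {t : ℝ} (h : HasDerivWithinAt f f' s t) :
    HasDerivWithinAt (fun t => L (f t)) (L f') s t := by
  rw [hasDerivWithinAt_iff_tendsto_inv_smul] at h ⊢
  simpa [Function.comp_def] using (L.continuous.tendsto 0).comp h

theorem abs_inv_mul_sub_sub_mul_le {c c' : ℝ → ℝ} {s : Set ℝ} (hs : Convex ℝ s)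
    (hc : ∀ x ∈ s, HasDerivAt c (c' x) x) {K : ℝ} (hK : ∀ x ∈ s, |c' x| ≤ K) {t y : ℝ}
    (ht : t ∈ s) (hy : y ∈ s) : |(y - t)⁻¹ * (c y - c t - (y - t) * c' t)| ≤ 2 * K := by
  rcases eq_or_ne y t with rfl | hyt
  · have := (abs_nonneg _).trans (hK y hy)
    simpa using this
  have hpos : 0 < |y - t| := abs_pos.2 (sub_ne_zero.2 hyt)
  have hincrement : |c y - c t| ≤ K * |y - t| :=
    hs.norm_image_sub_le_of_norm_hasDerivWithin_le (fun x hx => (hc x hx).hasDerivWithinAt) hK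
      ht hy
  have hlinear : |(y - t) * c' t| ≤ K * |y - t| := by
    rw [abs_mul, mul_comm]
    exact mul_le_mul_of_nonneg_right (hK t ht) (abs_nonneg _)
  rw [abs_mul, abs_inv, inv_mul_le_iff₀ hpos]
  linarith [abs_sub (c y - c t) ((y - t) * c' t)]

end DifferenceQuotient

section SchwartzSeries

variable {E F : Type*} [NormedAddCommGroup E] [NormedSpace ℝ E] [NormedAddCommGroup F]
  [NormedSpace ℝ F]

/-- Absolute convergence of the series `∑ f n` for every Schwartz seminorm. -/
def SeminormSummable (f : ℕ → 𝓢(E, F)) : Prop :=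
  ∀ k l, Summable fun n => SchwartzMap.seminorm ℝ k l (f n)

/-- Growth of each Schwartz seminorm of `f n` that is at most geometric in `n`. -/
def SeminormGeometric (f : ℕ → 𝓢(E, F)) : Prop :=
  ∀ k l, ∃ B R : ℝ, ∀ n, SchwartzMap.seminorm ℝ k l (f n) ≤ B * R ^ n

theorem ExpBounded.seminorm_smul_le {C M : ℝ} {c : ℕ → ℝ} (hc : ExpBounded C M c)
    {f : ℕ → 𝓢(E, F)} {k l : ℕ} {B R : ℝ}
    (hB : ∀ n, SchwartzMap.seminorm ℝ k l (f n) ≤ B * R ^ n) (n : ℕ) :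
    SchwartzMap.seminorm ℝ k l (c n • f n) ≤ C * B * ((M * R) ^ n / n.factorial) := by
  rw [map_smul_eq_mul, Real.norm_eq_abs]
  calc |c n| * SchwartzMap.seminorm ℝ k l (f n)
      ≤ C * (M ^ n / n.factorial) * (B * R ^ n) :=
        mul_le_mul (hc n) (hB n) (apply_nonneg _ _) ((abs_nonneg _).trans (hc n))
    _ = C * B * ((M * R) ^ n / n.factorial) := by rw [mul_pow]; ring

theorem SeminormGeometric.summable_smul {f : ℕ → 𝓢(E, F)} (hf : SeminormGeometric f) {C M : ℝ}
    {c : ℕ → ℝ} (hc : ExpBounded C M c) : SeminormSummable fun n => c n • f n := fun k l => by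
  obtain ⟨B, R, hB⟩ := hf k l
  exact .of_nonneg_of_le (fun n => apply_nonneg _ _) (hc.seminorm_smul_le hB)
    (summable_mul_pow_div_factorial (C * B) (M * R))

theorem SeminormSummable.summable_iteratedFDeriv {f : ℕ → 𝓢(E, F)} (h : SeminormSummable f)
    (k l : ℕ) (x : E) : Summable fun n => ‖x‖ ^ k * ‖iteratedFDeriv ℝ l (f n) x‖ :=
  .of_nonneg_of_le (fun n => by positivity) (fun n => SchwartzMap.le_seminorm ℝ k l (f n) x)
    (h k l)

theorem tendsto_tsum_seminorm_smul_zero {ι : Type*} {𝓕 : Filter ι}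
    {f : ℕ → 𝓢(E, F)} (hf : SeminormGeometric f) {r : ℕ → ι → ℝ} {C M : ℝ}
    (hr : ∀ᶠ y in 𝓕, ExpBounded C M (r · y)) (hlim : ∀ n, Tendsto (r n) 𝓕 (𝓝 0)) (k l : ℕ) :
    Tendsto (fun y => ∑' n, SchwartzMap.seminorm ℝ k l (r n y • f n)) 𝓕 (𝓝 0) := by
  obtain ⟨B, R, hB⟩ := hf k l
  rw [← tsum_zero (β := ℕ)]
  refine tendsto_tsum_of_dominated_convergence
    (summable_mul_pow_div_factorial (C * B) (M * R)) (fun n => ?_) ?_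
  · simpa only [map_smul_eq_mul, norm_zero, zero_mul] using
      (hlim n).norm.mul_const (SchwartzMap.seminorm ℝ k l (f n))
  · filter_upwards [hr] with y hy n
    rw [Real.norm_of_nonneg (apply_nonneg _ _)]
    exact hy.seminorm_smul_le hB n

variable [CompleteSpace F]

theorem SeminormSummable.summable_apply {f : ℕ → 𝓢(E, F)} (h : SeminormSummable f) (x : E) :
    Summable fun n => f n x :=
  .of_norm_bounded (h 0 0) fun n => SchwartzMap.norm_le_seminorm ℝ (f n) x

theorem SeminormSummable.pow_mul_norm_iteratedFDeriv_tsum_le {f : ℕ → 𝓢(E, F)}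
    (h : SeminormSummable f) (k l : ℕ) (x : E) :
    ‖x‖ ^ k * ‖iteratedFDeriv ℝ l (fun y => ∑' n, f n y) x‖ ≤
      ∑' n, SchwartzMap.seminorm ℝ k l (f n) := by
  have hderiv : iteratedFDeriv ℝ l (fun y => ∑' n, f n y) x =
      ∑' n, iteratedFDeriv ℝ l (f n) x :=
    iteratedFDeriv_tsum_apply (N := ⊤) (v := fun l n => SchwartzMap.seminorm ℝ 0 l (f n))
      (fun n => (f n).smooth ⊤) (fun l _ => h 0 l)
      (fun l n x _ => SchwartzMap.norm_iteratedFDeriv_le_seminorm ℝ (f n) l x) le_top x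
  have hsummable : Summable fun n => ‖iteratedFDeriv ℝ l (f n) x‖ := by
    simpa using h.summable_iteratedFDeriv 0 l x
  calc ‖x‖ ^ k * ‖iteratedFDeriv ℝ l (fun y => ∑' n, f n y) x‖
      ≤ ‖x‖ ^ k * ∑' n, ‖iteratedFDeriv ℝ l (f n) x‖ := by
        rw [hderiv]
        gcongr
        exact norm_tsum_le_tsum_norm hsummable
    _ = ∑' n, ‖x‖ ^ k * ‖iteratedFDeriv ℝ l (f n) x‖ := tsum_mul_left.symm
    _ ≤ ∑' n, SchwartzMap.seminorm ℝ k l (f n) :=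
      (h.summable_iteratedFDeriv k l x).tsum_le_tsum
        (fun n => SchwartzMap.le_seminorm ℝ k l (f n) x) (h k l)

/-- The sum of a series of Schwartz functions which converges absolutely for every seminorm. -/
noncomputable def SeminormSummable.sum {f : ℕ → 𝓢(E, F)} (h : SeminormSummable f) : 𝓢(E, F) where
  toFun x := ∑' n, f n x
  smooth' := contDiff_tsum (N := ⊤) (v := fun l n => SchwartzMap.seminorm ℝ 0 l (f n))
    (fun n => (f n).smooth ⊤) (fun l _ => h 0 l)
    (fun l n x _ => SchwartzMap.norm_iteratedFDeriv_le_seminorm ℝ (f n) l x)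
  decay' k l := ⟨_, h.pow_mul_norm_iteratedFDeriv_tsum_le k l⟩

theorem SeminormSummable.sum_apply {f : ℕ → 𝓢(E, F)} (h : SeminormSummable f) (x : E) :
    h.sum x = ∑' n, f n x := rfl

theorem SeminormSummable.seminorm_sum_le {f : ℕ → 𝓢(E, F)} (h : SeminormSummable f) (k l : ℕ) :
    SchwartzMap.seminorm ℝ k l h.sum ≤ ∑' n, SchwartzMap.seminorm ℝ k l (f n) :=
  SchwartzMap.seminorm_le_bound ℝ k l _ (tsum_nonneg fun _ => apply_nonneg _ _)
    (h.pow_mul_norm_iteratedFDeriv_tsum_le k l)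

theorem SeminormSummable.smul_sub_sub_smul_sum {f g h r : ℕ → 𝓢(E, F)}
    (hf : SeminormSummable f) (hg : SeminormSummable g) (hh : SeminormSummable h)
    (hr : SeminormSummable r) {α β : ℝ} (heq : ∀ n, r n = α • (f n - g n - β • h n)) :
    α • (hf.sum - hg.sum - β • hh.sum) = hr.sum := by
  ext x
  have sf := (hf.summable_apply x).hasSum
  have sg := (hg.summable_apply x).hasSum
  have sh := (hh.summable_apply x).hasSum
  simpa only [heq, sum_apply, smul_apply, sub_apply] using
    (((sf.sub sg).sub (sh.const_smul β)).const_smul α).tsum_eq.symm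

theorem SeminormGeometric.hasDerivWithinAt_sum {f : ℕ → 𝓢(E, F)} (hf : SeminormGeometric f)
    {c c' : ℕ → ℝ → ℝ} (hc : ∀ n t, HasDerivAt (c n) (c' n t) t) {t C M : ℝ}
    (hbound : ∀ y ∈ Metric.ball t 1, ExpBounded C M (c' · y))
    (hu : ∀ y, SeminormSummable fun n => c n y • f n)
    (hv : SeminormSummable fun n => c' n t • f n) (s : Set ℝ) :
    HasDerivWithinAt (fun y => (hu y).sum) hv.sum s t := by
  rw [hasDerivWithinAt_iff_tendsto_inv_smul]
  refine Tendsto.mono_left ?_ nhdsWithin_le_nhds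
  set r : ℕ → ℝ → ℝ := fun n y => (y - t)⁻¹ * (c n y - c n t - (y - t) * c' n t) with hr
  have hr_bound : ∀ y ∈ Metric.ball t 1, ExpBounded (2 * C) M (r · y) := fun y hy n =>
    (abs_inv_mul_sub_sub_mul_le (convex_ball t 1) (fun x _ => hc n x) (fun x hx => hbound x hx n)
      (Metric.mem_ball_self one_pos) hy).trans_eq (mul_assoc _ _ _).symm
  have hr_lim : ∀ n, Tendsto (r n) (𝓝 t) (𝓝 0) := fun n => by
    simpa only [hr, nhdsWithin_univ, smul_eq_mul] using
      (hasDerivWithinAt_iff_tendsto_inv_smul (s := univ)).1 (hc n t).hasDerivWithinAt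
  have hball : ∀ᶠ y in 𝓝 t, y ∈ Metric.ball t 1 := Metric.ball_mem_nhds t one_pos
  rw [(schwartz_withSeminorms ℝ E F).tendsto_nhds]
  rintro ⟨k, l⟩ ε hε
  have hsum_lim := tendsto_tsum_seminorm_smul_zero hf (hball.mono hr_bound) hr_lim k l
  filter_upwards [hsum_lim.eventually (gt_mem_nhds hε), hball] with y hy hyb
  rw [sub_zero, (hu y).smul_sub_sub_smul_sum (hu t) hv (hf.summable_smul (hr_bound y hyb))
    fun n => by simp only [hr, ← sub_smul, smul_smul]]
  exact (SeminormSummable.seminorm_sum_le _ k l).trans_lt hy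

end SchwartzSeries

section IteratedMultiplication

theorem tsupport_subset_of_forall_eq_smul {X R M : Type*} [TopologicalSpace X] [Zero M]
    [SMulZeroClass R M] {P : X → R} {f : ℕ → X → M}
    (hf : ∀ n, f (n + 1) = fun y => P y • f n y) (n : ℕ) : tsupport (f n) ⊆ tsupport (f 0) := by
  induction n with
  | zero => exact subset_rfl
  | succ n ih => exact (hf n ▸ tsupport_smul_subset_right P (f n)).trans ih

variable {E F : Type*} [NormedAddCommGroup E] [NormedSpace ℝ E] [NormedAddCommGroup F]
  [NormedSpace ℝ F]

theorem exists_norm_iteratedFDeriv_le {P : E → F} (hP : ContDiff ℝ ∞ P) {S : Set E}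
    (hS : IsCompact S) (l : ℕ) :
    ∃ G, 0 ≤ G ∧ ∀ i ≤ l, ∀ x ∈ S, ‖iteratedFDeriv ℝ i P x‖ ≤ G := by
  choose G hG using fun i : ℕ => hS.exists_bound_of_continuousOn
    (hP.continuous_iteratedFDeriv (m := i) (by exact_mod_cast le_top)).continuousOn
  refine ⟨∑ i ∈ Finset.range (l + 1), |G i|, Finset.sum_nonneg fun i _ => abs_nonneg _,
    fun i hi x hx => (hG i x hx).trans ((le_abs_self _).trans ?_)⟩
  exact Finset.single_le_sum (f := fun i => |G i|) (fun i _ => abs_nonneg _)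
    (Finset.mem_range_succ_iff.2 hi)

theorem norm_iteratedFDeriv_le_mul_pow {P : E → ℝ} (hP : ContDiff ℝ ∞ P) {f : ℕ → E → F}
    (hsmooth : ∀ n, ContDiff ℝ ∞ (f n)) (hf : ∀ n, f (n + 1) = fun y => P y • f n y) {l : ℕ}
    {x : E} {G B : ℝ} (hG : ∀ i ≤ l, ‖iteratedFDeriv ℝ i P x‖ ≤ G)
    (hB : ∀ j ≤ l, ‖iteratedFDeriv ℝ j (f 0) x‖ ≤ B) (n : ℕ) :
    ∀ j ≤ l, ‖iteratedFDeriv ℝ j (f n) x‖ ≤ B * (2 ^ l * G) ^ n := by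
  have hG0 : 0 ≤ G := (norm_nonneg _).trans (hG 0 l.zero_le)
  have hB0 : 0 ≤ B := (norm_nonneg _).trans (hB 0 l.zero_le)
  induction n with
  | zero => simpa using hB
  | succ n ih =>
    intro j hj
    rw [hf n]
    calc ‖iteratedFDeriv ℝ j (fun y => P y • f n y) x‖
        ≤ ∑ i ∈ Finset.range (j + 1), (j.choose i : ℝ) * ‖iteratedFDeriv ℝ i P x‖ *
          ‖iteratedFDeriv ℝ (j - i) (f n) x‖ :=
          norm_iteratedFDeriv_smul_le hP (hsmooth n) x (by exact_mod_cast le_top)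
      _ ≤ ∑ i ∈ Finset.range (j + 1), (j.choose i : ℝ) * G * (B * (2 ^ l * G) ^ n) := by
          refine Finset.sum_le_sum fun i hi => ?_
          have hi' := Finset.mem_range_succ_iff.1 hi
          gcongr
          exacts [hG i (hi'.trans hj), ih (j - i) ((Nat.sub_le _ _).trans hj)]
      _ = 2 ^ j * G * (B * (2 ^ l * G) ^ n) := by
          rw [← Finset.sum_mul, ← Finset.sum_mul, ← Nat.cast_sum, Nat.sum_range_choose,
            Nat.cast_pow, Nat.cast_ofNat]
      _ ≤ 2 ^ l * G * (B * (2 ^ l * G) ^ n) := by gcongr; exact one_le_two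
      _ = B * (2 ^ l * G) ^ (n + 1) := by ring

theorem seminormGeometric_of_forall_eq_smul {P : E → ℝ} (hP : ContDiff ℝ ∞ P)
    {f : ℕ → 𝓢(E, F)} (hf : ∀ n x, f (n + 1) x = P x • f n x) (hsupp : HasCompactSupport (f 0)) :
    SeminormGeometric f := fun k l => by
  have hf' : ∀ n, (f (n + 1) : E → F) = fun y => P y • f n y := fun n => funext (hf n)
  obtain ⟨ρ, hρ⟩ := hsupp.isCompact.isBounded.exists_norm_le
  obtain ⟨G, hG0, hG⟩ := exists_norm_iteratedFDeriv_le hP hsupp.isCompact l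
  obtain ⟨B, hB0, hB⟩ := exists_norm_iteratedFDeriv_le ((f 0).smooth ⊤) hsupp.isCompact l
  refine ⟨|ρ| ^ k * B, 2 ^ l * G, fun n =>
    SchwartzMap.seminorm_le_bound ℝ k l _ (by positivity) fun x => ?_⟩
  by_cases hx : x ∈ tsupport (f 0)
  · calc ‖x‖ ^ k * ‖iteratedFDeriv ℝ l (f n) x‖ ≤ |ρ| ^ k * (B * (2 ^ l * G) ^ n) := by
          gcongr
          · exact (hρ x hx).trans (le_abs_self _)
          · exact norm_iteratedFDeriv_le_mul_pow (f := fun n => f n) hP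
              (fun n => (f n).smooth ⊤) hf' (fun i hi => hG i hi x hx) (fun j hj => hB j hj x hx)
              n l le_rfl
      _ = |ρ| ^ k * B * (2 ^ l * G) ^ n := by ring
  · have hvanish : iteratedFDeriv ℝ l (f n) x = 0 := by
      by_contra hne
      exact hx (tsupport_subset_of_forall_eq_smul (f := fun n => f n) hf' n
        (support_iteratedFDeriv_subset l hne))
    rw [hvanish, norm_zero, mul_zero]
    positivity

theorem iterate_smulLeftCLM_apply {P : E → ℝ} (hP : P.HasTemperateGrowth) (χ : 𝓢(E, ℂ)) (n : ℕ)
    (ξ : E) : (SchwartzMap.smulLeftCLM ℂ P)^[n] χ ξ = P ξ ^ n • χ ξ := by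
  induction n with
  | zero => simp
  | succ n ih =>
    rw [Function.iterate_succ_apply', SchwartzMap.smulLeftCLM_apply_apply hP, ih, smul_smul,
      pow_succ']

end IteratedMultiplication

/-! ### The wave equation in frequency space -/

section FrequencySide

variable {E : Type*} [NormedAddCommGroup E] [NormedSpace ℝ E]

theorem SeminormSummable.sum_eq_smul_smulLeftCLM {P : E → ℝ} (hP : P.HasTemperateGrowth)
    {f g : ℕ → 𝓢(E, ℂ)} (hf : SeminormSummable f) (hg : SeminormSummable g) {α : ℝ}
    (hzero : g 0 = 0) (hsucc : ∀ n, g (n + 1) = α • SchwartzMap.smulLeftCLM ℂ P (f n)) :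
    hg.sum = α • SchwartzMap.smulLeftCLM ℂ P hf.sum := by
  ext ξ
  have hs := ((hf.summable_apply ξ).hasSum.const_smul (P ξ)).const_smul α
  rw [smul_apply, SchwartzMap.smulLeftCLM_apply_apply hP, hf.sum_apply, hg.sum_apply,
    ← hs.tsum_eq, (hg.summable_apply ξ).tsum_eq_zero_add, hzero, zero_apply, zero_add]
  simp only [hsucc, smul_apply, SchwartzMap.smulLeftCLM_apply_apply hP]

/-- Multiplying the series `∑ k, posTerm k t * P ξ ^ k` and its time derivatives by a compactly
supported `χ` makes them converge in the Schwartz space. -/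
theorem exists_odeSol_smul_curve {A : ℝ → ℝ} (hA : Continuous A) (t₀ x y : ℝ) {P : E → ℝ}
    (hP : P.HasTemperateGrowth) {χ : 𝓢(E, ℂ)} (hχ : HasCompactSupport χ) :
    ∃ U V : ℝ → 𝓢(E, ℂ), (∀ t s, HasDerivWithinAt U (V t) s t) ∧
      (∀ t s, HasDerivWithinAt V (A t • SchwartzMap.smulLeftCLM ℂ P (U t)) s t) ∧
      (∀ t ξ, U t ξ = odeSol A t₀ x y (P ξ) t • χ ξ) ∧
      ∀ t ξ, V t ξ = odeSolDeriv A t₀ x y (P ξ) t • χ ξ := by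
  set f : ℕ → 𝓢(E, ℂ) := fun n => (SchwartzMap.smulLeftCLM ℂ P)^[n] χ
  have hf_apply : ∀ n ξ, f n ξ = P ξ ^ n • χ ξ := iterate_smulLeftCLM_apply hP χ
  have hf : SeminormGeometric f := seminormGeometric_of_forall_eq_smul hP.1
    (fun n ξ => by rw [hf_apply, hf_apply, smul_smul, pow_succ']) hχ
  have hbound := exists_expBounded_terms hA t₀ x y
  have hpos_summable : ∀ t, SeminormSummable fun n => posTerm A t₀ x y n t • f n := fun t => by
    obtain ⟨C, M, h⟩ := hbound |t - t₀|
    exact hf.summable_smul (h t le_rfl).1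
  have hvel_summable : ∀ t, SeminormSummable fun n => velTerm A t₀ x y n t • f n := fun t => by
    obtain ⟨C, M, h⟩ := hbound |t - t₀|
    exact hf.summable_smul (h t le_rfl).2.1
  have hacc_summable : ∀ t, SeminormSummable fun n => accTerm A t₀ x y n t • f n := fun t => by
    obtain ⟨C, M, h⟩ := hbound |t - t₀|
    exact hf.summable_smul (h t le_rfl).2.2
  have hnear : ∀ {t s : ℝ}, s ∈ Metric.ball t 1 → |s - t₀| ≤ |t - t₀| + 1 := fun {t s} hs => by
    linarith [abs_sub_le s t t₀, Real.dist_eq s t, Metric.mem_ball.1 hs]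
  have hacc : ∀ t, (hacc_summable t).sum =
      A t • SchwartzMap.smulLeftCLM ℂ P (hpos_summable t).sum := fun t => by
    refine (hpos_summable t).sum_eq_smul_smulLeftCLM hP (hacc_summable t) ?_ fun n => ?_
    · rw [accTerm, zero_smul]
    · rw [map_smul, ← Function.iterate_succ_apply' (SchwartzMap.smulLeftCLM ℂ P), smul_smul,
        accTerm]
  refine ⟨fun t => (hpos_summable t).sum, fun t => (hvel_summable t).sum, fun t s => ?_,
    fun t s => ?_, fun t ξ => ?_, fun t ξ => ?_⟩
  · obtain ⟨C, M, h⟩ := hbound (|t - t₀| + 1)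
    exact hf.hasDerivWithinAt_sum (fun n t => hasDerivAt_posTerm hA n t)
      (fun y hy => (h y (hnear hy)).2.1) hpos_summable (hvel_summable t) s
  · obtain ⟨C, M, h⟩ := hbound (|t - t₀| + 1)
    rw [← hacc]
    exact hf.hasDerivWithinAt_sum (fun n t => hasDerivAt_velTerm hA n t)
      (fun y hy => (h y (hnear hy)).2.2) hvel_summable (hacc_summable t) s
  · have := ((hasSum_odeSol (t₀ := t₀) (x := x) (y := y) hA (P ξ) t).smul_const (χ ξ)).tsum_eq
    rw [SeminormSummable.sum_apply, ← this]
    simp only [smul_apply, hf_apply, smul_smul, RCLike.ofReal_real_eq_id, id]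
  · have := ((hasSum_odeSolDeriv (t₀ := t₀) (x := x) (y := y) hA (P ξ) t).smul_const
      (χ ξ)).tsum_eq
    rw [SeminormSummable.sum_apply, ← this]
    simp only [smul_apply, hf_apply, smul_smul, RCLike.ofReal_real_eq_id, id]

end FrequencySide

section Fourier

open FourierTransform

theorem fourier_laplacian_apply {d : ℕ} (f : 𝓢(Space d, ℂ)) (ξ : Space d) :
    𝓕 (Δ f) ξ = (-(2 * Real.pi * ‖ξ‖) ^ 2) • 𝓕 f ξ := by
  rw [SchwartzMap.laplacian_eq_fourierMultiplierCLM, SchwartzMap.fourierMultiplierCLM_apply,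
    FourierTransform.fourier_smul, FourierTransform.fourier_fourierInv_eq, smul_apply,
    SchwartzMap.smulLeftCLM_apply_apply (by fun_prop), smul_smul]
  ring_nf

theorem norm_fourier_lineDeriv_single_sq {d : ℕ} (f : 𝓢(Space d, ℂ)) (j : Fin d) (ξ : Space d) :
    ‖𝓕 (∂_{(EuclideanSpace.single j 1 : Space d)} f) ξ‖ ^ 2 =
      (2 * Real.pi) ^ 2 * (ξ j ^ 2 * ‖𝓕 f ξ‖ ^ 2) := by
  rw [SchwartzMap.fourier_lineDerivOp_eq, smul_apply,
    SchwartzMap.smulLeftCLM_apply_apply (by fun_prop)]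
  simp [mul_pow, EuclideanSpace.inner_single_right]

theorem integrable_schwartz_norm_sq {d : ℕ} (f : 𝓢(Space d, ℂ)) :
    MeasureTheory.Integrable fun x => ‖f x‖ ^ 2 :=
  (f.memLp 2).integrable_norm_pow two_ne_zero

/-- Twice the energy density of the state `(f, g)` in frequency space. -/
noncomputable def fourierEnergyDensity {d : ℕ} (f g : 𝓢(Space d, ℂ)) (ξ : Space d) : ℝ :=
  (2 * Real.pi * ‖ξ‖) ^ 2 * ‖𝓕 f ξ‖ ^ 2 + ‖𝓕 g ξ‖ ^ 2

theorem fourierEnergyDensity_nonneg {d : ℕ} (f g : 𝓢(Space d, ℂ)) :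
    0 ≤ fourierEnergyDensity f g := fun ξ => by
  simp only [fourierEnergyDensity, Pi.zero_apply]; positivity

theorem continuous_fourierEnergyDensity {d : ℕ} (f g : 𝓢(Space d, ℂ)) :
    Continuous (fourierEnergyDensity f g) := by
  have hf : Continuous fun ξ => 𝓕 f ξ := (𝓕 f).continuous
  have hg : Continuous fun ξ => 𝓕 g ξ := (𝓕 g).continuous
  unfold fourierEnergyDensity
  fun_prop

theorem fourierEnergyDensity_eq_sum {d : ℕ} (f g : 𝓢(Space d, ℂ)) (ξ : Space d) :
    fourierEnergyDensity f g ξ =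
      (∑ j, ‖𝓕 (∂_{(EuclideanSpace.single j 1 : Space d)} f) ξ‖ ^ 2) + ‖𝓕 g ξ‖ ^ 2 := by
  simp only [fourierEnergyDensity, norm_fourier_lineDeriv_single_sq, ← Finset.mul_sum,
    ← Finset.sum_mul]
  simp only [mul_pow, EuclideanSpace.norm_sq_eq, Real.norm_eq_abs, sq_abs, mul_assoc]

theorem integrable_fourierEnergyDensity {d : ℕ} (f g : 𝓢(Space d, ℂ)) :
    MeasureTheory.Integrable (fourierEnergyDensity f g) := by
  rw [funext (fourierEnergyDensity_eq_sum f g)]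
  exact (MeasureTheory.integrable_finsetSum _ fun j _ => integrable_schwartz_norm_sq _).add
    (integrable_schwartz_norm_sq _)

theorem energy_eq_integral_fourierEnergyDensity {d : ℕ} (f g : 𝓢(Space d, ℂ)) :
    energy f g = (1 / 2) * ∫ ξ, fourierEnergyDensity f g ξ := by
  have hsplit : ∀ (F : Fin d → 𝓢(Space d, ℂ)) (G : 𝓢(Space d, ℂ)),
      ∫ x, ((∑ j, ‖F j x‖ ^ 2) + ‖G x‖ ^ 2) = (∑ j, ∫ x, ‖F j x‖ ^ 2) + ∫ x, ‖G x‖ ^ 2 :=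
    fun F G => by
      rw [MeasureTheory.integral_add (MeasureTheory.integrable_finsetSum _ fun j _ =>
        integrable_schwartz_norm_sq _) (integrable_schwartz_norm_sq _),
        MeasureTheory.integral_finsetSum _ fun j _ => integrable_schwartz_norm_sq _]
  simp only [energy, fourierEnergyDensity_eq_sum, hsplit, SchwartzMap.integral_norm_sq_fourier]

theorem energy_pos {d : ℕ} {f g : 𝓢(Space d, ℂ)} {ξ : Space d}
    (hξ : 0 < fourierEnergyDensity f g ξ) : 0 < energy f g := by
  rw [energy_eq_integral_fourierEnergyDensity]
  exact mul_pos one_half_pos (MeasureTheory.integral_pos_of_integrable_nonneg_nonzero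
    (continuous_fourierEnergyDensity f g) (integrable_fourierEnergyDensity f g)
    (fourierEnergyDensity_nonneg f g) hξ.ne')

theorem mul_energy_le_energy {d : ℕ} {f g f' g' : 𝓢(Space d, ℂ)} {G : ℝ}
    (h : ∀ ξ, G * fourierEnergyDensity f g ξ ≤ fourierEnergyDensity f' g' ξ) :
    G * energy f g ≤ energy f' g' := by
  rw [energy_eq_integral_fourierEnergyDensity, energy_eq_integral_fourierEnergyDensity,
    mul_left_comm, ← MeasureTheory.integral_const_mul]
  exact mul_le_mul_of_nonneg_left (MeasureTheory.integral_mono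
    ((integrable_fourierEnergyDensity f g).const_mul G) (integrable_fourierEnergyDensity f' g') h)
    one_half_pos.le

theorem schwartz_ext_fourier {d : ℕ} {f g : 𝓢(Space d, ℂ)} (h : ∀ ξ, 𝓕 f ξ = 𝓕 g ξ) : f = g := by
  simpa using congrArg (fun g : 𝓢(Space d, ℂ) => (𝓕⁻ g : 𝓢(Space d, ℂ))) (SchwartzMap.ext h)

theorem exists_wave_curve {d : ℕ} {a : ℝ → ℝ} (ha : Continuous fun t => a t ^ 2) (t₀ x y : ℝ)
    {χ : 𝓢(Space d, ℂ)} (hχ : HasCompactSupport χ) :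
    ∃ u v : ℝ → 𝓢(Space d, ℂ), (∀ t s, HasDerivWithinAt u (v t) s t) ∧
      (∀ t s, HasDerivWithinAt v ((a t ^ 2) • Δ (u t)) s t) ∧
      (∀ t ξ, 𝓕 (u t) ξ =
        odeSol (fun t => a t ^ 2) t₀ x y (-(2 * Real.pi * ‖ξ‖) ^ 2) t • χ ξ) ∧
      ∀ t ξ, 𝓕 (v t) ξ =
        odeSolDeriv (fun t => a t ^ 2) t₀ x y (-(2 * Real.pi * ‖ξ‖) ^ 2) t • χ ξ := by
  set P : Space d → ℝ := fun ξ => -(2 * Real.pi * ‖ξ‖) ^ 2 with hP_def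
  have hP : P.HasTemperateGrowth := by
    simp only [hP_def, mul_pow]
    fun_prop
  obtain ⟨U, V, hU, hV, hUeq, hVeq⟩ := exists_odeSol_smul_curve ha t₀ x y hP hχ
  have hinv : ∀ t, fourierInvCLM ℝ 𝓢(Space d, ℂ) (a t ^ 2 • SchwartzMap.smulLeftCLM ℂ P (U t)) =
      a t ^ 2 • Δ (𝓕⁻ (U t) : 𝓢(Space d, ℂ)) := fun t => schwartz_ext_fourier fun ξ => by
    rw [fourierInvCLM_apply, FourierTransform.fourier_fourierInv_eq,
      FourierTransform.fourier_smul, smul_apply, smul_apply, fourier_laplacian_apply,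
      FourierTransform.fourier_fourierInv_eq, SchwartzMap.smulLeftCLM_apply_apply hP]
  refine ⟨fun t => 𝓕⁻ (U t), fun t => 𝓕⁻ (V t), fun t s =>
    hasDerivWithinAt_continuousLinearMap_apply (fourierInvCLM ℝ 𝓢(Space d, ℂ)) (hU t s),
    fun t s => hinv t ▸
      hasDerivWithinAt_continuousLinearMap_apply (fourierInvCLM ℝ 𝓢(Space d, ℂ)) (hV t s),
    fun t ξ => ?_, fun t ξ => ?_⟩
  · rw [FourierTransform.fourier_fourierInv_eq, hUeq]
  · rw [FourierTransform.fourier_fourierInv_eq, hVeq]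

/-- Evaluation of the Fourier transform at `ξ`, which turns wave solutions into solutions of
`w'' = -(2π‖ξ‖)² a² w`. -/
noncomputable def fourierEvalCLM {d : ℕ} (ξ : Space d) : 𝓢(Space d, ℂ) →L[ℝ] ℂ :=
  ((BoundedContinuousFunction.evalCLM ℝ ξ).comp
    (SchwartzMap.toBoundedContinuousFunctionCLM ℝ (Space d) ℂ)).comp
    (fourierCLM ℝ 𝓢(Space d, ℂ))

theorem fourierEvalCLM_apply {d : ℕ} (ξ : Space d) (f : 𝓢(Space d, ℂ)) :
    fourierEvalCLM ξ f = 𝓕 f ξ := rfl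

theorem IsWaveSolution.unique {d : ℕ} {a : ℝ → ℝ} (ha : Continuous fun t => a t ^ 2)
    {u₀ u₁ : 𝓢(Space d, ℂ)} {u v u' v' : ℝ → 𝓢(Space d, ℂ)} (h : IsWaveSolution a u₀ u₁ u v)
    (h' : IsWaveSolution a u₀ u₁ u' v') {T : ℝ} (hT : 0 ≤ T) : u T = u' T ∧ v T = v' T := by
  have hpos : ∀ {u v}, IsWaveSolution a u₀ u₁ u v → ∀ ξ, ∀ t ∈ Icc 0 T, HasDerivWithinAt
      (fun t => fourierEvalCLM ξ (u t)) (fourierEvalCLM ξ (v t)) (Icc 0 T) t := fun h ξ t ht =>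
    (hasDerivWithinAt_continuousLinearMap_apply _ (h.deriv_pos t ht.1)).mono Icc_subset_Ici_self
  have hvel : ∀ {u v}, IsWaveSolution a u₀ u₁ u v → ∀ ξ, ∀ t ∈ Icc 0 T, HasDerivWithinAt
      (fun t => fourierEvalCLM ξ (v t))
      ((a t ^ 2 * -(2 * Real.pi * ‖ξ‖) ^ 2) • fourierEvalCLM ξ (u t)) (Icc 0 T) t :=
    fun h ξ t ht => by
      have hderiv := hasDerivWithinAt_continuousLinearMap_apply (fourierEvalCLM ξ)
        (h.deriv_vel t ht.1)
      rw [map_smul, fourierEvalCLM_apply ξ (Δ _), fourier_laplacian_apply,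
        ← fourierEvalCLM_apply, smul_smul] at hderiv
      exact hderiv.mono Icc_subset_Ici_self
  have hunique := fun ξ => secondOrderODE_solution_unique
    (ha.mul continuous_const).continuousOn (hpos h ξ) (hvel h ξ) (hpos h' ξ) (hvel h' ξ)
    (by rw [h.init_pos, h'.init_pos]) (by rw [h.init_vel, h'.init_vel]) T (right_mem_Icc.2 hT)
  exact ⟨schwartz_ext_fourier fun ξ => (hunique ξ).1, schwartz_ext_fourier fun ξ => (hunique ξ).2⟩

end Fourier

/-! ### The oscillating coefficient -/

section Profile

variable {φ : ℝ → ℝ}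

theorem IsProfile.eventuallyEq_zero (hφ : IsProfile φ) {x : ℝ} (hx : x ∉ Ioo (0 : ℝ) 1) :
    φ =ᶠ[𝓝 x] 0 :=
  notMem_tsupport_iff_eventuallyEq.1 fun h => hx (hφ.support h)

theorem IsProfile.eq_zero (hφ : IsProfile φ) {x : ℝ} (hx : x ∉ Ioo (0 : ℝ) 1) : φ x = 0 :=
  (hφ.eventuallyEq_zero hx).eq_of_nhds

theorem IsProfile.iteratedDeriv_eq_zero (hφ : IsProfile φ) (l : ℕ) {x : ℝ}
    (hx : x ∉ Ioo (0 : ℝ) 1) : iteratedDeriv l φ x = 0 := by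
  have hzero : φ =ᶠ[𝓝 x] fun _ => 0 := hφ.eventuallyEq_zero hx
  rw [hzero.iteratedDeriv_eq, iteratedDeriv_const, ite_self]

theorem IsProfile.exists_iteratedDeriv_bound (hφ : IsProfile φ) (l : ℕ) :
    ∃ C : ℝ, 0 ≤ C ∧ ∀ x, |iteratedDeriv l φ x| ≤ C := by
  obtain ⟨C, hC⟩ := isCompact_Icc.exists_bound_of_continuousOn (s := Icc (0 : ℝ) 1)
    (hφ.smooth.continuous_iteratedDeriv l (by exact_mod_cast le_top)).continuousOn
  have hC0 : 0 ≤ C := (norm_nonneg _).trans (hC 0 (by simp))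
  refine ⟨C, hC0, fun x => ?_⟩
  by_cases hx : x ∈ Icc (0 : ℝ) 1
  · exact hC x hx
  · rwa [hφ.iteratedDeriv_eq_zero l fun h => hx (Ioo_subset_Icc_self h), abs_zero]

theorem IsProfile.exists_lower_bound (hφ : IsProfile φ) : ∃ m : ℝ, 0 < m ∧ ∀ x, m ≤ 1 + φ x := by
  obtain ⟨x₀, -, hx₀⟩ := isCompact_Icc.exists_isMinOn (s := Icc (0 : ℝ) 1) (by simp)
    hφ.smooth.continuous.continuousOn
  have hlower : -1 < φ x₀ := (abs_lt.1 (hφ.abs_lt_one x₀)).1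
  refine ⟨1 + φ x₀, by linarith, fun x => add_le_add_right ?_ 1⟩
  by_cases hx : x ∈ Icc (0 : ℝ) 1
  · exact hx₀ hx
  · rw [hφ.eq_zero fun h => hx (Ioo_subset_Icc_self h), ← hφ.eq_zero (x := 0) (by simp)]
    exact hx₀ (by simp)

theorem IsProfile.exists_deriv_ne_zero (hφ : IsProfile φ) : ∃ x ∈ Ioo (0 : ℝ) 1, deriv φ x ≠ 0 := by
  by_contra! h
  have hderiv : ∀ x, deriv φ x = 0 := fun x => by
    by_cases hx : x ∈ Ioo (0 : ℝ) 1
    · exact h x hx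
    · simpa only [iteratedDeriv_one] using hφ.iteratedDeriv_eq_zero 1 hx
  refine hφ.ne_zero (funext fun x => ?_)
  rw [is_const_of_deriv_eq_zero (hφ.smooth.differentiable (by simp)) hderiv x 0,
    hφ.eq_zero (by simp), Pi.zero_apply]

theorem IsProfile.periodisation_of_mem (hφ : IsProfile φ) {j : ℤ} {s : ℝ}
    (hs : s ∈ Icc (j : ℝ) (j + 1)) : periodisation φ s = φ (s - j) := by
  rcases hs.2.lt_or_eq with h | h
  · rw [periodisation, Int.floor_eq_iff.2 ⟨hs.1, h⟩]
  · have hfloor : ⌊s⌋ = j + 1 := by rw [h]; exact_mod_cast Int.floor_intCast (j + 1)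
    rw [periodisation, hfloor, h, hφ.eq_zero (by simp), hφ.eq_zero (by simp)]

theorem IsProfile.periodisation_eventuallyEq (hφ : IsProfile φ) (s : ℝ) :
    periodisation φ =ᶠ[𝓝 s] fun t => φ (t - ⌊s⌋) := by
  have hlower : (⌊s⌋ : ℝ) ≤ s := Int.floor_le s
  have hprevious : ∀ᶠ t in 𝓝 s, φ (t - (⌊s⌋ - 1 : ℤ)) = 0 :=
    (continuous_sub_right _).continuousAt.eventually (hφ.eventuallyEq_zero fun h => by
      have := h.2
      push_cast at this
      linarith)
  filter_upwards [hprevious, Ioo_mem_nhds (by linarith : (⌊s⌋ : ℝ) - 1 < s)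
    (Int.lt_floor_add_one s)] with t ht hts
  rcases le_or_gt (⌊s⌋ : ℝ) t with h | h
  · exact hφ.periodisation_of_mem ⟨h, hts.2.le⟩
  · rw [hφ.periodisation_of_mem (j := ⌊s⌋ - 1) (by push_cast; exact ⟨hts.1.le, by linarith⟩), ht,
      hφ.eq_zero fun h' => by linarith [h'.1]]

theorem IsProfile.periodisation_eventuallyEq_zero (hφ : IsProfile φ) (j : ℤ) :
    periodisation φ =ᶠ[𝓝 (j : ℝ)] 0 := by
  have hzero : ∀ᶠ t in 𝓝 (j : ℝ), φ (t - j) = 0 :=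
    (continuous_sub_right _).continuousAt.eventually (hφ.eventuallyEq_zero (by simp))
  filter_upwards [hφ.periodisation_eventuallyEq j, hzero] with t ht ht0
  rw [ht, Int.floor_intCast, ht0, Pi.zero_apply]

theorem IsProfile.contDiff_periodisation (hφ : IsProfile φ) : ContDiff ℝ ∞ (periodisation φ) :=
  contDiff_iff_contDiffAt.2 fun s =>
    (hφ.smooth.comp (contDiff_id.sub contDiff_const)).contDiffAt.congr_of_eventuallyEq
      (hφ.periodisation_eventuallyEq s)

theorem IsProfile.iteratedDeriv_periodisation (hφ : IsProfile φ) (l : ℕ) (s : ℝ) :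
    iteratedDeriv l (periodisation φ) s = iteratedDeriv l φ (s - ⌊s⌋) := by
  rw [(hφ.periodisation_eventuallyEq s).iteratedDeriv_eq, iteratedDeriv_comp_sub_const]

theorem IsProfile.exists_isLUB_logDeriv (hφ : IsProfile φ) : ∃ c : ℝ, 0 < c ∧
    IsLUB (Set.range fun s : ℝ => |deriv (periodisation φ) s| / (1 + periodisation φ s)) c := by
  obtain ⟨m, hm, hmφ⟩ := hφ.exists_lower_bound
  obtain ⟨C, hC0, hC⟩ := hφ.exists_iteratedDeriv_bound 1
  have hderiv : ∀ s, deriv (periodisation φ) s = deriv φ (s - ⌊s⌋) := fun s => by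
    simpa only [iteratedDeriv_one] using hφ.iteratedDeriv_periodisation 1 s
  have hlub := isLUB_csSup (s := Set.range fun s : ℝ =>
    |deriv (periodisation φ) s| / (1 + periodisation φ s)) (range_nonempty _) ⟨C / m, by
      rintro _ ⟨s, rfl⟩
      rw [iteratedDeriv_one] at hC
      simp only [hderiv]
      exact div_le_div₀ hC0 (hC _) hm (hmφ _)⟩
  obtain ⟨x, hx, hx_deriv⟩ := hφ.exists_deriv_ne_zero
  refine ⟨_, lt_of_lt_of_le ?_ (hlub.1 ⟨x, rfl⟩), hlub⟩
  have hfloor : ⌊x⌋ = 0 := Int.floor_eq_zero_iff.2 ⟨hx.1.le, hx.2⟩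
  simp only [hderiv, hfloor, Int.cast_zero, sub_zero]
  exact div_pos (abs_pos.2 hx_deriv) (hm.trans_le (hmφ _))

end Profile

section Coefficient

variable {φ : ℝ → ℝ} {τ δ : ℕ → ℝ} {n : ℕ → ℕ}

theorem IsAdmissible.add_lt (h : IsAdmissible τ δ n) {i j : ℕ} (hi : 1 ≤ i) (hij : i < j) :
    τ i + δ i < τ j := by
  induction j, hij using Nat.le_induction with
  | base => exact h.separated i hi
  | succ j hj ih =>
    linarith [h.separated j (by lia), h.length_pos j (by lia)]

theorem IsAdmissible.mem_unique (h : IsAdmissible τ δ n) {i j : ℕ} (hi : 1 ≤ i) (hj : 1 ≤ j)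
    {t : ℝ} (hti : t ∈ Icc (τ i) (τ i + δ i)) (htj : t ∈ Icc (τ j) (τ j + δ j)) : i = j := by
  rcases lt_trichotomy i j with hij | hij | hij
  · linarith [h.add_lt hi hij, hti.2, htj.1]
  · exact hij
  · linarith [h.add_lt hj hij, htj.2, hti.1]

theorem IsAdmissible.rate_pos (h : IsAdmissible τ δ n) {k : ℕ} (hk : 1 ≤ k) :
    0 < (n k : ℝ) / δ k :=
  div_pos (Nat.cast_pos.2 (h.count_pos k hk)) (h.length_pos k hk)

theorem IsAdmissible.eventually_mem_imp_mem (h : IsAdmissible τ δ n) (t : ℝ) :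
    ∀ᶠ s in 𝓝 t, ∀ k, s ∈ Icc (τ k) (τ k + δ k) → t ∈ Icc (τ k) (τ k + δ k) := by
  have hfinite : LocallyFinite fun k => Icc (τ k) (τ k + δ k) := fun t => by
    obtain ⟨N, hN⟩ := (h.tendsto.eventually_ge_atTop (t + 1)).exists_forall_of_atTop
    refine ⟨Iio (t + 1), Iio_mem_nhds (lt_add_one t), (finite_lt_nat N).subset ?_⟩
    rintro k ⟨s, hs, hst⟩
    exact not_le.1 fun hk => (hN k hk).not_gt (hs.1.trans_lt hst)
  exact hfinite.eventually_subset (fun k => isClosed_Icc) t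

theorem coefficient_of_notMem {t : ℝ} (ht : ∀ k, 1 ≤ k → t ∉ Icc (τ k) (τ k + δ k)) :
    coefficient φ τ δ n t = 1 :=
  dif_neg fun ⟨k, hk, htk⟩ => ht k hk htk

theorem IsAdmissible.coefficient_eventuallyEq_one (h : IsAdmissible τ δ n) {t : ℝ}
    (ht : ∀ k, 1 ≤ k → t ∉ Icc (τ k) (τ k + δ k)) : coefficient φ τ δ n =ᶠ[𝓝 t] 1 := by
  filter_upwards [h.eventually_mem_imp_mem t] with s hs
  exact coefficient_of_notMem fun k hk hsk => ht k hk (hs k hsk)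

theorem IsAdmissible.coefficient_eventuallyEq (h : IsAdmissible τ δ n) (hφ : IsProfile φ) {k : ℕ}
    (hk : 1 ≤ k) {t : ℝ} (ht : t ∈ Icc (τ k) (τ k + δ k)) :
    coefficient φ τ δ n =ᶠ[𝓝 t] fun s => 1 + periodisation φ ((n k : ℝ) / δ k * (s - τ k)) := by
  have hδ : δ k ≠ 0 := (h.length_pos k hk).ne'
  have houtside : ∀ᶠ s in 𝓝 t, s ∉ Icc (τ k) (τ k + δ k) →
      periodisation φ ((n k : ℝ) / δ k * (s - τ k)) = 0 := by
    by_cases hinterior : t ∈ Ioo (τ k) (τ k + δ k)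
    · filter_upwards [Icc_mem_nhds hinterior.1 hinterior.2] with s hs hs'
      exact absurd hs hs'
    have hphase : ∃ j : ℤ, (n k : ℝ) / δ k * (t - τ k) = j := by
      rcases ht.1.eq_or_lt with rfl | hlt
      · exact ⟨0, by simp⟩
      · have hend : t = τ k + δ k := ht.2.eq_or_lt.resolve_right fun hgt => hinterior ⟨hlt, hgt⟩
        exact ⟨n k, by rw [hend, add_sub_cancel_left, div_mul_cancel₀ _ hδ, Int.cast_natCast]⟩
    obtain ⟨j, hj⟩ := hphase
    have hcont : ContinuousAt (fun s => (n k : ℝ) / δ k * (s - τ k)) t := by fun_prop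
    rw [ContinuousAt, hj] at hcont
    filter_upwards [hcont.eventually (hφ.periodisation_eventuallyEq_zero j)] with s hs _ using hs
  filter_upwards [h.eventually_mem_imp_mem t, houtside] with s hs hs_outside
  by_cases hsk : s ∈ Icc (τ k) (τ k + δ k)
  · exact coefficient_of_mem h hk hsk
  · rw [hs_outside hsk, add_zero]
    refine coefficient_of_notMem fun j hj hsj => hsk ?_
    rwa [← h.mem_unique hj hk (hs j hsj) ht]

theorem IsAdmissible.contDiff_coefficient (h : IsAdmissible τ δ n) (hφ : IsProfile φ) :
    ContDiff ℝ ∞ (coefficient φ τ δ n) := by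
  refine contDiff_iff_contDiffAt.2 fun t => ?_
  by_cases ht : ∃ k, 1 ≤ k ∧ t ∈ Icc (τ k) (τ k + δ k)
  · obtain ⟨k, hk, htk⟩ := ht
    have hsmooth : ContDiff ℝ ∞ fun s => 1 + periodisation φ ((n k : ℝ) / δ k * (s - τ k)) :=
      contDiff_const.add (hφ.contDiff_periodisation.comp (by fun_prop))
    exact hsmooth.contDiffAt.congr_of_eventuallyEq (h.coefficient_eventuallyEq hφ hk htk)
  · push Not at ht
    exact contDiffAt_const.congr_of_eventuallyEq (h.coefficient_eventuallyEq_one ht)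

theorem IsAdmissible.iteratedDeriv_coefficient_of_notMem (h : IsAdmissible τ δ n) {l : ℕ}
    (hl : 0 < l) {t : ℝ} (ht : ∀ k, 1 ≤ k → t ∉ Icc (τ k) (τ k + δ k)) :
    iteratedDeriv l (coefficient φ τ δ n) t = 0 := by
  have hone : coefficient φ τ δ n =ᶠ[𝓝 t] fun _ => 1 := h.coefficient_eventuallyEq_one ht
  rw [hone.iteratedDeriv_eq, iteratedDeriv_const, if_neg hl.ne']

theorem IsAdmissible.iteratedDeriv_coefficient_of_mem (h : IsAdmissible τ δ n)
    (hφ : IsProfile φ) {k : ℕ} (hk : 1 ≤ k) {l : ℕ} (hl : 0 < l) {t : ℝ}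
    (ht : t ∈ Icc (τ k) (τ k + δ k)) :
    iteratedDeriv l (coefficient φ τ δ n) t = ((n k : ℝ) / δ k) ^ l *
      iteratedDeriv l (periodisation φ) ((n k : ℝ) / δ k * (t - τ k)) := by
  rw [(h.coefficient_eventuallyEq hφ hk ht).iteratedDeriv_eq, iteratedDeriv_const_add hl,
    iteratedDeriv_comp_sub_const l (fun s => periodisation φ ((n k : ℝ) / δ k * s)),
    iteratedDeriv_comp_const_mul (hφ.contDiff_periodisation.of_le (by exact_mod_cast le_top))]

theorem IsAdmissible.exists_coefficient_bounds (h : IsAdmissible τ δ n) (hφ : IsProfile φ) :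
    ∃ m : ℝ, 0 < m ∧ ∀ t, m ≤ coefficient φ τ δ n t ∧ coefficient φ τ δ n t < 2 := by
  obtain ⟨m, hm, hmφ⟩ := hφ.exists_lower_bound
  refine ⟨m, hm, fun t => ?_⟩
  by_cases ht : ∃ k, 1 ≤ k ∧ t ∈ Icc (τ k) (τ k + δ k)
  · obtain ⟨k, hk, htk⟩ := ht
    rw [coefficient_of_mem h hk htk, periodisation]
    refine ⟨hmφ _, ?_⟩
    rw [← one_add_one_eq_two]
    gcongr
    exact (abs_lt.1 (hφ.abs_lt_one _)).2
  · push Not at ht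
    rw [coefficient_of_notMem ht]
    refine ⟨?_, one_lt_two⟩
    simpa only [hφ.eq_zero (x := 0) (by simp), add_zero] using hmφ 0

end Coefficient

/-! ### Oscillator energy along the coefficient -/

theorem oscillatorEnergy_le_exp_mul {a w v : ℝ → ℝ} {ρ γ s t : ℝ} (ha : Differentiable ℝ a)
    (hpos : ∀ r, 0 < a r) (hw : ∀ r, HasDerivAt w (v r) r)
    (hv : ∀ r, HasDerivAt v (-ρ ^ 2 * a r ^ 2 * w r) r)
    (hlog : ∀ r ∈ Ioo s t, |deriv a r| ≤ γ * a r) (hst : s ≤ t) (has : a s = 1) (hat : a t = 1) :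
    oscillatorEnergy ρ (w s) (v s)
      ≤ Real.exp (2 * (γ * (t - s))) * oscillatorEnergy ρ (w t) (v t) := by
  have hv' : ∀ r, HasDerivAt (fun r => (v r : ℂ))
      ((Complex.I * ρ) ^ 2 * (a r ^ 2 : ℝ) * (w r : ℂ)) r := fun r => by
    refine (hv r).ofReal_comp.congr_deriv ?_
    push_cast
    rw [mul_pow, Complex.I_sq]
    ring
  have hle := hillEnergy_le_mul_exp_of_le ha hpos (fun r => (hw r).ofReal_comp) hv' hlog hst
  have henergy : ∀ r, a r = 1 → hillEnergy a (Complex.I * ρ) (fun r => (w r : ℂ))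
      (fun r => (v r : ℂ)) r = oscillatorEnergy ρ (w r) (v r) := fun r hr => by
    simp only [hillEnergy, oscillatorEnergy, hr, norm_mul, Complex.norm_I, Complex.norm_real,
      Real.norm_eq_abs, one_mul, sq_abs, one_pow, mul_one]
    ring
  rwa [henergy s has, henergy t hat, Complex.I_mul_re, Complex.ofReal_im, neg_zero,
    abs_zero, zero_mul, zero_add, mul_comm] at hle

open Matrix in
theorem monodromy_mulVec_rescale {A c : ℝ → ℝ} (hA : Continuous A) {r α z : ℝ} (hr : 0 < r)
    {w v : ℝ → ℝ} (hw : ∀ t, HasDerivAt w (v t) t)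
    (hv : ∀ t, HasDerivAt v (z * r ^ 2 * c t * w t) t)
    (hc : ∀ t ∈ Icc α (α + 1 / r), c t = A (r * (t - α))) :
    monodromy A z *ᵥ ![w α, v α / r] = ![w (α + 1 / r), v (α + 1 / r) / r] := by
  set x : ℝ := w α with hx
  set y : ℝ := v α / r with hy
  have hphase : ∀ t, HasDerivAt (fun t => r * (t - α)) r t := fun t => by
    simpa only [mul_one] using ((hasDerivAt_id' t).sub_const α).const_mul r
  have hpos : ∀ t, HasDerivAt (fun t => odeSol A 0 x y z (r * (t - α)))
      (odeSolDeriv A 0 x y z (r * (t - α)) * r) t := fun t =>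
    (hasDerivAt_odeSol (𝕜 := ℝ) hA z _).comp t (hphase t)
  have hvel : ∀ t, HasDerivAt (fun t => odeSolDeriv A 0 x y z (r * (t - α)) * r)
      ((z * r ^ 2 * A (r * (t - α))) • odeSol A 0 x y z (r * (t - α))) t := fun t =>
    (((hasDerivAt_odeSolDeriv (𝕜 := ℝ) hA z _).comp t (hphase t)).mul_const r).congr_deriv (by
      simp only [RCLike.ofReal_real_eq_id, id, smul_eq_mul]
      ring)
  obtain ⟨hw_end, hv_end⟩ := secondOrderODE_solution_unique
    (c := fun t => z * r ^ 2 * A (r * (t - α))) (by fun_prop)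
    (fun t _ => (hw t).hasDerivWithinAt)
    (fun t ht => (hc t ht ▸ hv t).hasDerivWithinAt)
    (fun t _ => (hpos t).hasDerivWithinAt) (fun t _ => (hvel t).hasDerivWithinAt)
    (by simp only [sub_self, mul_zero, odeSol_self, RCLike.ofReal_real_eq_id, id, hx])
    (by simp only [sub_self, mul_zero, odeSolDeriv_self, RCLike.ofReal_real_eq_id, id, hy]
        rw [div_mul_cancel₀ _ hr.ne'])
    (α + 1 / r) (right_mem_Icc.2 (le_add_of_nonneg_right (by positivity)))
  rw [add_sub_cancel_left, mul_one_div_cancel hr.ne'] at hw_end hv_end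
  rw [monodromy_mulVec hA, hw_end, hv_end, mul_div_cancel_right₀ _ hr.ne']

section CoefficientEnergy

variable {φ : ℝ → ℝ} {τ δ : ℕ → ℝ} {n : ℕ → ℕ}

theorem IsAdmissible.coefficient_left (h : IsAdmissible τ δ n) (hφ : IsProfile φ) {k : ℕ}
    (hk : 1 ≤ k) : coefficient φ τ δ n (τ k) = 1 := by
  have hzero : periodisation φ 0 = 0 := by
    simpa using (hφ.periodisation_eventuallyEq_zero 0).eq_of_nhds
  rw [coefficient_of_mem h hk (left_mem_Icc.2 (le_add_of_nonneg_right (h.length_pos k hk).le)),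
    sub_self, mul_zero, hzero, add_zero]

theorem IsAdmissible.coefficient_right (h : IsAdmissible τ δ n) (hφ : IsProfile φ) {k : ℕ}
    (hk : 1 ≤ k) : coefficient φ τ δ n (τ k + δ k) = 1 := by
  have hzero : periodisation φ (n k) = 0 := by
    simpa using (hφ.periodisation_eventuallyEq_zero (n k)).eq_of_nhds
  rw [coefficient_of_mem h hk (right_mem_Icc.2 (le_add_of_nonneg_right (h.length_pos k hk).le)),
    add_sub_cancel_left, div_mul_cancel₀ _ (h.length_pos k hk).ne', hzero, add_zero]

theorem IsAdmissible.coefficient_pos (h : IsAdmissible τ δ n) (hφ : IsProfile φ) (t : ℝ) :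
    0 < coefficient φ τ δ n t := by
  obtain ⟨m, hm, hb⟩ := h.exists_coefficient_bounds hφ
  exact hm.trans_le (hb t).1

theorem IsAdmissible.differentiable_coefficient (h : IsAdmissible τ δ n) (hφ : IsProfile φ) :
    Differentiable ℝ (coefficient φ τ δ n) :=
  (h.contDiff_coefficient hφ).differentiable (by simp)

theorem IsAdmissible.abs_deriv_coefficient_le (h : IsAdmissible τ δ n) (hφ : IsProfile φ) {c : ℝ}
    (hc : ∀ s, |deriv (periodisation φ) s| ≤ c * (1 + periodisation φ s)) {k : ℕ} (hk : 1 ≤ k)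
    {t : ℝ} (ht : t ∈ Icc (τ k) (τ k + δ k)) :
    |deriv (coefficient φ τ δ n) t| ≤ c * (n k / δ k) * coefficient φ τ δ n t := by
  have hderiv := h.iteratedDeriv_coefficient_of_mem hφ hk one_pos ht
  rw [iteratedDeriv_one, iteratedDeriv_one, pow_one] at hderiv
  rw [hderiv, coefficient_of_mem h hk ht, abs_mul, abs_of_pos (h.rate_pos hk), mul_right_comm,
    mul_comm]
  exact mul_le_mul_of_nonneg_right (hc _) (h.rate_pos hk).le

theorem IsAdmissible.notMem_of_lt_start (h : IsAdmissible τ δ n) {t : ℝ} (ht : t < τ 1) {k : ℕ}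
    (hk : 1 ≤ k) : t ∉ Icc (τ k) (τ k + δ k) := fun htk => by
  rcases hk.eq_or_lt with rfl | hk1
  · exact ht.not_ge htk.1
  · linarith [htk.1, h.add_lt le_rfl hk1, h.length_pos 1 le_rfl]

theorem IsAdmissible.notMem_of_mem_gap (h : IsAdmissible τ δ n) {k : ℕ} (hk : 1 ≤ k) {t : ℝ}
    (ht : t ∈ Ioo (τ k + δ k) (τ (k + 1))) {j : ℕ} (hj : 1 ≤ j) :
    t ∉ Icc (τ j) (τ j + δ j) := fun htj => by
  rcases lt_trichotomy j k with hjk | rfl | hjk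
  · linarith [h.add_lt hj hjk, h.length_pos k hk, htj.2, ht.1]
  · exact ht.1.not_ge htj.2
  · rcases (Nat.succ_le_of_lt hjk).eq_or_lt with rfl | hlt
    · exact ht.2.not_ge htj.1
    · linarith [h.add_lt (by lia) hlt, h.length_pos (k + 1) (by lia), htj.1, ht.2]

theorem IsAdmissible.coefficient_zero (h : IsAdmissible τ δ n) (hφ : IsProfile φ) :
    coefficient φ τ δ n 0 = 1 := by
  rcases h.start_nonneg.eq_or_lt with h0 | h0
  · rw [h0, h.coefficient_left hφ le_rfl]
  · exact coefficient_of_notMem fun k hk => h.notMem_of_lt_start h0 hk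

section Oscillator

variable {ρ : ℝ} {w v : ℝ → ℝ} (hw : ∀ r, HasDerivAt w (v r) r)
  (hv : ∀ r, HasDerivAt v (-ρ ^ 2 * coefficient φ τ δ n r ^ 2 * w r) r)

include hw hv

theorem IsAdmissible.oscillatorEnergy_gap_le (h : IsAdmissible τ δ n) (hφ : IsProfile φ)
    {s t : ℝ} (hst : s ≤ t) (hgap : ∀ r ∈ Ioo s t, ∀ k, 1 ≤ k → r ∉ Icc (τ k) (τ k + δ k))
    (hs : coefficient φ τ δ n s = 1) (ht : coefficient φ τ δ n t = 1) :
    oscillatorEnergy ρ (w s) (v s) ≤ oscillatorEnergy ρ (w t) (v t) := by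
  have hlog : ∀ r ∈ Ioo s t, |deriv (coefficient φ τ δ n) r| ≤ 0 * coefficient φ τ δ n r :=
    fun r hr => by
      rw [← iteratedDeriv_one, h.iteratedDeriv_coefficient_of_notMem one_pos (hgap r hr), abs_zero,
        zero_mul]
  simpa using oscillatorEnergy_le_exp_mul (h.differentiable_coefficient hφ) (h.coefficient_pos hφ)
    hw hv hlog hst hs ht

theorem IsAdmissible.oscillatorEnergy_interval_le (h : IsAdmissible τ δ n) (hφ : IsProfile φ)
    {c : ℝ} (hc : ∀ s, |deriv (periodisation φ) s| ≤ c * (1 + periodisation φ s)) {k : ℕ}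
    (hk : 1 ≤ k) : oscillatorEnergy ρ (w (τ k)) (v (τ k))
      ≤ Real.exp (2 * c * n k) * oscillatorEnergy ρ (w (τ k + δ k)) (v (τ k + δ k)) := by
  have hδ : 0 < δ k := h.length_pos k hk
  have hle := oscillatorEnergy_le_exp_mul (h.differentiable_coefficient hφ) (h.coefficient_pos hφ)
    hw hv (fun r hr => h.abs_deriv_coefficient_le hφ hc hk (Ioo_subset_Icc_self hr))
    (le_add_of_nonneg_right hδ.le) (h.coefficient_left hφ hk) (h.coefficient_right hφ hk)
  rwa [add_sub_cancel_left, mul_assoc c, div_mul_cancel₀ _ hδ.ne', ← mul_assoc] at hle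

theorem IsAdmissible.oscillatorEnergy_zero_le (h : IsAdmissible τ δ n) (hφ : IsProfile φ) {c : ℝ}
    (hc : ∀ s, |deriv (periodisation φ) s| ≤ c * (1 + periodisation φ s)) {k : ℕ} (hk : 1 ≤ k) :
    oscillatorEnergy ρ (w 0) (v 0) ≤ Real.exp (2 * c * ∑ l ∈ Finset.Ico 1 k, (n l : ℝ)) *
      oscillatorEnergy ρ (w (τ k)) (v (τ k)) := by
  induction k, hk using Nat.le_induction with
  | base =>
    simpa using h.oscillatorEnergy_gap_le hw hv hφ h.start_nonneg
      (fun r hr k hk => h.notMem_of_lt_start hr.2 hk) (h.coefficient_zero hφ)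
      (h.coefficient_left hφ le_rfl)
  | succ k hk ih =>
    have hgap := h.oscillatorEnergy_gap_le hw hv hφ (h.separated k hk).le
      (fun r hr j hj => h.notMem_of_mem_gap hk hr hj) (h.coefficient_right hφ hk)
      (h.coefficient_left hφ (by lia))
    rw [Finset.sum_Ico_succ_top hk, mul_add, Real.exp_add, mul_assoc]
    calc oscillatorEnergy ρ (w 0) (v 0) ≤ _ := ih
      _ ≤ _ := by
        gcongr
        exact (h.oscillatorEnergy_interval_le hw hv hφ hc hk).trans
          (mul_le_mul_of_nonneg_left hgap (Real.exp_pos _).le)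

open Matrix

theorem IsAdmissible.monodromy_pow_mulVec (h : IsAdmissible τ δ n) (hφ : IsProfile φ) {k : ℕ}
    (hk : 1 ≤ k) {r : ℝ} (hr : r = n k / δ k) {j : ℕ} (hj : j ≤ n k) :
    monodromy (fun s => (1 + φ s) ^ 2) (-(ρ / r) ^ 2) ^ j *ᵥ ![w (τ k), v (τ k) / r]
      = ![w (τ k + j / r), v (τ k + j / r) / r] := by
  have hr0 : 0 < r := hr ▸ h.rate_pos hk
  induction j with
  | zero => simp
  | succ j ih =>
    have hcoef : ∀ t ∈ Icc (τ k + j / r) (τ k + j / r + 1 / r),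
        coefficient φ τ δ n t ^ 2 = (1 + φ (r * (t - (τ k + j / r)))) ^ 2 := fun t ht => by
      have hphase : r * (t - (τ k + j / r)) = r * (t - τ k) - (j : ℤ) := by
        push_cast
        field_simp
        ring
      have hlower : (j : ℝ) ≤ r * (t - τ k) := (div_le_iff₀' hr0).1 (by linarith [ht.1])
      have hupper : r * (t - τ k) ≤ j + 1 := by
        rw [← le_div_iff₀' hr0, add_div]
        linarith [ht.2]
      have hj' : (j : ℝ) + 1 ≤ n k := mod_cast hj
      have hlength : (n k : ℝ) / r = δ k := by
        rw [hr, div_div_cancel₀ (Nat.cast_ne_zero.2 (h.count_pos k hk).ne')]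
      have hmem : t ∈ Icc (τ k) (τ k + δ k) := by
        refine ⟨by linarith [ht.1, div_nonneg j.cast_nonneg hr0.le], ?_⟩
        rw [← hlength]
        linarith [(le_div_iff₀' hr0).2 (hupper.trans hj')]
      rw [coefficient_of_mem h hk hmem, ← hr, hphase,
        hφ.periodisation_of_mem ⟨mod_cast hlower, mod_cast hupper⟩]
    rw [pow_succ', ← mulVec_mulVec, ih (by lia), monodromy_mulVec_rescale
      (by have := hφ.smooth.continuous; fun_prop) hr0 hw (fun t => (hv t).congr_deriv (by
        field_simp)) hcoef]
    push_cast
    rw [add_assoc, ← add_div]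

theorem IsAdmissible.exp_mul_oscillatorEnergy_le (h : IsAdmissible τ δ n) (hφ : IsProfile φ)
    {k : ℕ} (hk : 1 ≤ k) {r κ : ℝ} (hr : r = n k / δ k) {e : Fin 2 → ℝ}
    (hgrow : ∀ N : ℕ, Real.exp (2 * κ * N) * oscillatorEnergy (ρ / r) (e 0) (e 1)
      ≤ oscillatorEnergy (ρ / r) ((monodromy (fun s => (1 + φ s) ^ 2) (-(ρ / r) ^ 2) ^ N *ᵥ e) 0)
        ((monodromy (fun s => (1 + φ s) ^ 2) (-(ρ / r) ^ 2) ^ N *ᵥ e) 1))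
    (hwe : w (τ k) = e 0) (hve : v (τ k) = r * e 1) :
    Real.exp (2 * κ * n k) * oscillatorEnergy ρ (w (τ k)) (v (τ k))
      ≤ oscillatorEnergy ρ (w (τ k + δ k)) (v (τ k + δ k)) := by
  have hr0 : 0 < r := hr ▸ h.rate_pos hk
  have hlength : (n k : ℝ) / r = δ k := by
    rw [hr, div_div_cancel₀ (Nat.cast_ne_zero.2 (h.count_pos k hk).ne')]
  have hscale : ∀ x y, oscillatorEnergy ρ x y = r ^ 2 * oscillatorEnergy (ρ / r) x (y / r) :=
    fun x y => by
      unfold oscillatorEnergy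
      field_simp
  have he : e = ![w (τ k), v (τ k) / r] := by
    ext i
    fin_cases i
    · exact hwe.symm
    · simp [hve, hr0.ne']
  have hgrow' := hgrow (n k)
  rw [he, h.monodromy_pow_mulVec hw hv hφ hk hr le_rfl, hlength] at hgrow'
  rw [hscale, hscale, mul_left_comm]
  exact mul_le_mul_of_nonneg_left hgrow' (sq_nonneg r)

end Oscillator

end CoefficientEnergy

open Matrix in
theorem IsProfile.exists_resonance {φ : ℝ → ℝ} (hφ : IsProfile φ) :
    ∃ κ : ℝ, 0 < κ ∧ ∃ e : Fin 2 → ℝ, e ≠ 0 ∧ ∃ l₀ : ℝ, 0 < l₀ ∧ ∀ᶠ l in 𝓝 l₀, ∀ N : ℕ,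
      Real.exp (2 * κ * N) * oscillatorEnergy l (e 0) (e 1)
        ≤ oscillatorEnergy l ((monodromy (fun s => (1 + φ s) ^ 2) (-l ^ 2) ^ N *ᵥ e) 0)
          ((monodromy (fun s => (1 + φ s) ^ 2) (-l ^ 2) ^ N *ᵥ e) 1) := by
  obtain ⟨m, hm, hmφ⟩ := hφ.exists_lower_bound
  have hzero : φ 0 = 0 := hφ.eq_zero (by simp)
  have hnonconst : ∃ t ∈ Icc (0 : ℝ) 1, 1 + φ t ≠ 1 + φ 0 := by
    obtain ⟨t, ht⟩ := Function.ne_iff.1 hφ.ne_zero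
    refine ⟨t, by_contra fun h => ht (hφ.eq_zero fun h' => h (Ioo_subset_Icc_self h')), ?_⟩
    rwa [hzero, Ne, add_right_inj]
  have hφ_C1 : ContDiff ℝ 1 fun t => 1 + φ t :=
    contDiff_const.add (hφ.smooth.of_le (by exact_mod_cast le_top))
  obtain ⟨l₀, hl₀, hdiscr⟩ := exists_two_lt_abs_hillDiscriminant hφ_C1
    (fun t => hm.trans_le (hmφ t)) (by rw [hzero, hφ.eq_zero (by simp)]) hnonconst
  have hcont : Continuous fun t => (1 + φ t) ^ 2 := hφ_C1.continuous.pow 2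
  obtain ⟨κ, hκ, e, he, hgrow⟩ := exists_exp_mul_oscillatorEnergy_le
    (M := fun l => monodromy (fun t => (1 + φ t) ^ 2) (-l ^ 2))
    ((continuous_monodromy hcont).comp (by fun_prop)) (fun l => det_monodromy hcont _) hl₀.ne'
    (by rwa [trace_monodromy])
  exact ⟨κ, hκ, e, he, l₀, hl₀, hgrow⟩

/-! ### Resonant data -/

theorem energy_smul {d : ℕ} (s : ℝ) (f g : 𝓢(Space d, ℂ)) :
    energy (s • f) (s • g) = s ^ 2 * energy f g := by
  have hdensity : ∀ ξ,
      fourierEnergyDensity (s • f) (s • g) ξ = s ^ 2 * fourierEnergyDensity f g ξ := fun ξ => by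
    simp only [fourierEnergyDensity, FourierTransform.fourier_smul, smul_apply, norm_smul, mul_pow,
      Real.norm_eq_abs, sq_abs]
    ring
  simp only [energy_eq_integral_fourierEnergyDensity, hdensity, MeasureTheory.integral_const_mul]
  ring

theorem IsWaveSolution.const_smul {d : ℕ} {a : ℝ → ℝ} {u₀ u₁ : 𝓢(Space d, ℂ)}
    {u v : ℝ → 𝓢(Space d, ℂ)} (h : IsWaveSolution a u₀ u₁ u v) (s : ℝ) :
    IsWaveSolution a (s • u₀) (s • u₁) (s • u) (s • v) := by
  have hlaplacian : ∀ t, Δ (s • u t) = s • Δ (u t) := fun t => by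
    simp only [← SchwartzMap.laplacianCLM_eq', map_smul]
  have hderiv : ∀ {f : ℝ → 𝓢(Space d, ℂ)} {f' t}, HasDerivWithinAt f f' (Ici 0) t →
      HasDerivWithinAt (s • f) (s • f') (Ici 0) t :=
    hasDerivWithinAt_continuousLinearMap_apply
      (s • ContinuousLinearMap.id ℝ 𝓢(Space d, ℂ))
  refine ⟨congrArg (s • ·) h.init_pos, congrArg (s • ·) h.init_vel,
    fun t ht => hderiv (h.deriv_pos t ht), fun t ht => ?_⟩
  rw [Pi.smul_apply, hlaplacian, smul_comm]
  exact hderiv (h.deriv_vel t ht)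

theorem IsWaveSolution.exists_energy_eq_one {d : ℕ} {a : ℝ → ℝ} (ha : Continuous fun t => a t ^ 2)
    {u₀ u₁ : 𝓢(Space d, ℂ)} {u v : ℝ → 𝓢(Space d, ℂ)} (h : IsWaveSolution a u₀ u₁ u v)
    (hpos : 0 < energy u₀ u₁) {T G : ℝ} (hT : 0 ≤ T)
    (hG : G * energy u₀ u₁ ≤ energy (u T) (v T)) :
    ∃ w₀ w₁ : 𝓢(Space d, ℂ), energy w₀ w₁ = 1 ∧ (∃ w w', IsWaveSolution a w₀ w₁ w w') ∧
      ∀ w w', IsWaveSolution a w₀ w₁ w w' → G ≤ energy (w T) (w' T) := by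
  set s := √(energy u₀ u₁)⁻¹
  have hs : s ^ 2 = (energy u₀ u₁)⁻¹ := Real.sq_sqrt (inv_nonneg.2 hpos.le)
  refine ⟨s • u₀, s • u₁, ?_, ⟨_, _, h.const_smul s⟩, fun w w' hw => ?_⟩
  · rw [energy_smul, hs, inv_mul_cancel₀ hpos.ne']
  · obtain ⟨hpos_eq, hvel_eq⟩ := hw.unique ha (h.const_smul s) hT
    rw [hpos_eq, hvel_eq, Pi.smul_apply, Pi.smul_apply, energy_smul, hs, inv_mul_eq_div]
    exact (le_div_iff₀ hpos).2 hG

theorem fourierEnergyDensity_of_fourier_eq_smul {d : ℕ} {f g χ : 𝓢(Space d, ℂ)} {ξ : Space d}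
    {w v : ℝ} (hf : FourierTransform.fourier f ξ = w • χ ξ)
    (hg : FourierTransform.fourier g ξ = v • χ ξ) :
    fourierEnergyDensity f g ξ = oscillatorEnergy (2 * Real.pi * ‖ξ‖) w v * ‖χ ξ‖ ^ 2 := by
  simp only [fourierEnergyDensity, hf, hg, norm_smul, mul_pow, Real.norm_eq_abs, sq_abs,
    oscillatorEnergy]
  ring

theorem exists_schwartz_bump {E : Type*} [NormedAddCommGroup E] [NormedSpace ℝ E]
    [FiniteDimensional ℝ E] {s : Set E} {ξ₀ : E} (hs : s ∈ 𝓝 ξ₀) :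
    ∃ χ : 𝓢(E, ℂ), HasCompactSupport χ ∧ χ ξ₀ ≠ 0 ∧ ∀ ξ ∉ s, χ ξ = 0 := by
  obtain ⟨f, hfs, hfc, hf, -, hf1⟩ := exists_contDiff_tsupport_subset (n := ⊤) hs
  have hcompact : HasCompactSupport fun ξ => (f ξ : ℂ) :=
    hfc.comp_left (g := fun x : ℝ => (x : ℂ)) Complex.ofReal_zero
  have hsmooth : ContDiff ℝ ∞ fun ξ => (f ξ : ℂ) := Complex.ofRealCLM.contDiff.comp hf
  refine ⟨hcompact.toSchwartzMap hsmooth, hcompact, ?_, fun ξ hξ => ?_⟩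
  · change (f ξ₀ : ℂ) ≠ 0
    rw [hf1, Complex.ofReal_one]
    exact one_ne_zero
  · change (f ξ : ℂ) = 0
    rw [image_eq_zero_of_notMem_tsupport fun h => hξ (hfs h), Complex.ofReal_zero]

theorem oscillatorEnergy_zero_pos {a w v : ℝ → ℝ} {ρ T : ℝ} (ha : Continuous fun t => a t ^ 2)
    (hT : 0 ≤ T) (hρ : ρ ≠ 0) (hw : ∀ r, HasDerivAt w (v r) r)
    (hv : ∀ r, HasDerivAt v (-ρ ^ 2 * a r ^ 2 * w r) r) (hne : w T ≠ 0 ∨ v T ≠ 0) :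
    0 < oscillatorEnergy ρ (w 0) (v 0) := by
  refine oscillatorEnergy_pos hρ ?_
  contrapose! hne
  exact secondOrderODE_solution_unique (c := fun t => -ρ ^ 2 * a t ^ 2)
    (ha.const_mul _).continuousOn
    (fun t _ => (hw t).hasDerivWithinAt) (fun t _ => (hv t).hasDerivWithinAt)
    (w₂ := fun _ => 0) (v₂ := fun _ => 0) (fun t _ => hasDerivWithinAt_const _ _ _)
    (fun t _ => by simpa using hasDerivWithinAt_const t (Icc 0 T) (0 : ℝ)) hne.1 hne.2
    T (right_mem_Icc.2 hT)

theorem exists_normalised_amplified_data {d : ℕ} {a : ℝ → ℝ} (ha : Continuous fun t => a t ^ 2)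
    {t₀ x y T G : ℝ} (hT : 0 ≤ T) {w v : Space d → ℝ → ℝ}
    (hw : ∀ ξ, w ξ = odeSol (fun t => a t ^ 2) t₀ x y (-(2 * Real.pi * ‖ξ‖) ^ 2))
    (hv : ∀ ξ, v ξ = odeSolDeriv (fun t => a t ^ 2) t₀ x y (-(2 * Real.pi * ‖ξ‖) ^ 2))
    {ξ₀ : Space d} (hpos : 0 < oscillatorEnergy (2 * Real.pi * ‖ξ₀‖) (w ξ₀ 0) (v ξ₀ 0))
    (hgrow : ∀ᶠ ξ in 𝓝 ξ₀, G * oscillatorEnergy (2 * Real.pi * ‖ξ‖) (w ξ 0) (v ξ 0) ≤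
      oscillatorEnergy (2 * Real.pi * ‖ξ‖) (w ξ T) (v ξ T)) :
    ∃ u₀ u₁ : 𝓢(Space d, ℂ), energy u₀ u₁ = 1 ∧ (∃ u v, IsWaveSolution a u₀ u₁ u v) ∧
      ∀ u v, IsWaveSolution a u₀ u₁ u v → G ≤ energy (u T) (v T) := by
  obtain ⟨χ, hχ, hχ₀, hχ_support⟩ := exists_schwartz_bump hgrow
  obtain ⟨u, u', hu, hu', hfu, hfu'⟩ := exists_wave_curve ha t₀ x y hχ
  simp only [← hw, ← hv] at hfu hfu'
  have hdensity := fun t ξ => fourierEnergyDensity_of_fourier_eq_smul (hfu t ξ) (hfu' t ξ)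
  have hsol : IsWaveSolution a (u 0) (u' 0) u u' :=
    ⟨rfl, rfl, fun t _ => hu t _, fun t _ => hu' t _⟩
  refine hsol.exists_energy_eq_one ha (energy_pos (ξ := ξ₀) ?_) hT
    (mul_energy_le_energy fun ξ => ?_)
  · rw [hdensity]
    exact mul_pos hpos (pow_pos (norm_pos_iff.2 hχ₀) 2)
  · rw [hdensity, hdensity, ← mul_assoc]
    by_cases hξ : χ ξ = 0
    · simp [hξ]
    · exact mul_le_mul_of_nonneg_right (not_imp_comm.1 (hχ_support ξ) hξ) (sq_nonneg _)

section Resonance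

variable {φ : ℝ → ℝ} {τ δ : ℕ → ℝ} {n : ℕ → ℕ}

theorem IsAdmissible.left_nonneg (h : IsAdmissible τ δ n) {k : ℕ} (hk : 1 ≤ k) : 0 ≤ τ k := by
  rcases hk.eq_or_lt with rfl | hk1
  · exact h.start_nonneg
  · linarith [h.add_lt le_rfl hk1, h.length_pos 1 le_rfl, h.start_nonneg]

theorem exists_norm_div_eq {d : ℕ} (hd : 1 ≤ d) {r l : ℝ} (hr : 0 < r) (hl : 0 ≤ l) :
    ∃ ξ : Space d, 2 * Real.pi * ‖ξ‖ / r = l := by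
  refine ⟨EuclideanSpace.single ⟨0, hd⟩ (l * r / (2 * Real.pi)), ?_⟩
  rw [PiLp.norm_single, Real.norm_of_nonneg (by positivity)]
  field_simp

theorem exp_sub_mul_le_of_le {p q x y z : ℝ} (hxy : x ≤ Real.exp q * y)
    (hyz : Real.exp p * y ≤ z) : Real.exp (p - q) * x ≤ z := by
  calc Real.exp (p - q) * x ≤ Real.exp (p - q) * (Real.exp q * y) := by gcongr
    _ = Real.exp p * y := by rw [← mul_assoc, ← Real.exp_add, sub_add_cancel]
    _ ≤ z := hyz

theorem IsProfile.exists_resonant_data {d : ℕ} (hd : 1 ≤ d) (hφ : IsProfile φ) :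
    ∃ κ : ℝ, 0 < κ ∧ ∀ c : ℝ,
      (∀ s, |deriv (periodisation φ) s| ≤ c * (1 + periodisation φ s)) →
      ∀ (τ δ : ℕ → ℝ) (n : ℕ → ℕ), IsAdmissible τ δ n → ∀ k, 1 ≤ k →
        ∃ u₀ u₁ : 𝓢(Space d, ℂ), energy u₀ u₁ = 1 ∧
          (∃ u v, IsWaveSolution (coefficient φ τ δ n) u₀ u₁ u v) ∧
          ∀ u v, IsWaveSolution (coefficient φ τ δ n) u₀ u₁ u v →
            Real.exp (2 * κ * n k - 2 * c * ∑ l ∈ Finset.Ico 1 k, (n l : ℝ)) ≤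
              energy (u (τ k + δ k)) (v (τ k + δ k)) := by
  obtain ⟨κ, hκ, e, he, l₀, hl₀, hresonance⟩ := hφ.exists_resonance
  refine ⟨κ, hκ, fun c hc τ δ n h k hk => ?_⟩
  set r := (n k : ℝ) / δ k with hr
  have hr0 : 0 < r := h.rate_pos hk
  have ha : Continuous fun t => coefficient φ τ δ n t ^ 2 :=
    (h.contDiff_coefficient hφ).continuous.pow 2
  obtain ⟨ξ₀, hξ₀⟩ := exists_norm_div_eq hd hr0 hl₀.le
  have hw := fun (ξ : Space d) => hasDerivAt_odeSol (𝕜 := ℝ) (t₀ := τ k) (x := e 0) (y := r * e 1)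
    ha (-(2 * Real.pi * ‖ξ‖) ^ 2)
  have hv := fun (ξ : Space d) => hasDerivAt_odeSolDeriv (𝕜 := ℝ) (t₀ := τ k) (x := e 0)
    (y := r * e 1) ha (-(2 * Real.pi * ‖ξ‖) ^ 2)
  refine exists_normalised_amplified_data ha
    (add_nonneg (h.left_nonneg hk) (h.length_pos k hk).le) (fun _ => rfl) (fun _ => rfl)
    (oscillatorEnergy_zero_pos ha (h.left_nonneg hk) (fun h0 => ?_) (hw ξ₀) (hv ξ₀) ?_) ?_
  · rw [h0, zero_div] at hξ₀
    exact hl₀.ne hξ₀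
  · rw [odeSol_self, odeSolDeriv_self]
    contrapose! he
    ext i
    fin_cases i
    exacts [he.1, (mul_eq_zero.1 he.2).resolve_left hr0.ne']
  · have hcont : Continuous fun ξ : Space d => 2 * Real.pi * ‖ξ‖ / r := by fun_prop
    filter_upwards [hcont.continuousAt.eventually (hξ₀ ▸ hresonance)] with ξ hξ
    exact exp_sub_mul_le_of_le (h.oscillatorEnergy_zero_le (hw ξ) (hv ξ) hφ hc hk)
      (h.exp_mul_oscillatorEnergy_le (hw ξ) (hv ξ) hφ hk hr hξ (odeSol_self _)
        (odeSolDeriv_self _))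

end Resonance

/-! ### Geometric parameters -/

theorem not_exists_energy_le_of_tendsto {d : ℕ} {a : ℝ → ℝ} {S T : ℕ → ℝ}
    (hS : Tendsto S atTop atTop) (hT : ∀ k, 1 ≤ k → 0 ≤ T k)
    (hdata : ∀ k, 1 ≤ k → ∃ u₀ u₁ : 𝓢(Space d, ℂ), energy u₀ u₁ = 1 ∧
      (∃ u v, IsWaveSolution a u₀ u₁ u v) ∧
      ∀ u v, IsWaveSolution a u₀ u₁ u v → Real.exp (S k) ≤ energy (u (T k)) (v (T k))) :
    ¬ ∃ C : ℝ, ∀ (u₀ u₁ : 𝓢(Space d, ℂ)) (u v : ℝ → 𝓢(Space d, ℂ)),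
      IsWaveSolution a u₀ u₁ u v → ∀ t : ℝ, 0 ≤ t → energy (u t) (v t) ≤ C * energy u₀ u₁ := by
  rintro ⟨C, hC⟩
  obtain ⟨k, hk, hkC⟩ := ((eventually_ge_atTop 1).and
    ((Real.tendsto_exp_atTop.comp hS).eventually_gt_atTop C)).exists
  obtain ⟨u₀, u₁, hone, ⟨u, v, huv⟩, hgrow⟩ := hdata k hk
  have hle := hC u₀ u₁ u v huv (T k) (hT k hk)
  rw [hone, mul_one] at hle
  exact (hkC.trans_le (hgrow u v huv)).not_ge hle

theorem rpow_le_three_rpow_abs_mul {x y : ℝ} (hx : 0 < x) (hxy : x ≤ y) (hyx : y ≤ 3 * x) (p : ℝ) :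
    x ^ p ≤ 3 ^ |p| * y ^ p := by
  have hy : 0 < y := hx.trans_le hxy
  rcases le_total 0 p with hp | hp
  · calc x ^ p ≤ y ^ p := Real.rpow_le_rpow hx.le hxy hp
      _ ≤ 3 ^ |p| * y ^ p := le_mul_of_one_le_left (Real.rpow_nonneg hy.le _)
        (Real.one_le_rpow (by norm_num) (abs_nonneg p))
  · calc x ^ p = 3 ^ |p| * (3 * x) ^ p := by
          rw [Real.mul_rpow (by norm_num) hx.le, ← mul_assoc, ← Real.rpow_add (by norm_num),
            abs_of_nonpos hp, neg_add_cancel, Real.rpow_zero, one_mul]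
      _ ≤ 3 ^ |p| * y ^ p := mul_le_mul_of_nonneg_left
        (Real.rpow_le_rpow_of_nonpos hy hyx hp) (by positivity)

/-- The parameters `τ_k = σᵏ`, `δ_k = σᵏ⁻¹`, `n_k = ⌈σ^(q k)⌉` of the second part of the theorem;
as for `IsAdmissible`, the values at `k = 0` are irrelevant. -/
def IsGeometric (σ q : ℝ) (τ δ : ℕ → ℝ) (n : ℕ → ℕ) : Prop :=
  ∀ k, 1 ≤ k → τ k = σ ^ k ∧ δ k = σ ^ (k - 1) ∧ n k = ⌈σ ^ (q * (k : ℝ))⌉₊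

section Geometric

variable {σ q : ℝ} {τ δ : ℕ → ℝ} {n : ℕ → ℕ}

theorem IsGeometric.isAdmissible (h : IsGeometric σ q τ δ n) (hσ : 2 ≤ σ) :
    IsAdmissible τ δ n := by
  have hσ0 : 0 < σ := by linarith
  refine ⟨?_, fun k hk => ?_, fun k hk => ?_, fun k hk => ?_, ?_⟩
  · rw [(h 1 le_rfl).1]
    positivity
  · rw [(h k hk).2.1]
    positivity
  · rw [(h k hk).2.2]
    exact Nat.ceil_pos.2 (Real.rpow_pos_of_pos hσ0 _)
  · obtain ⟨j, rfl⟩ := Nat.exists_eq_add_of_le' hk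
    rw [(h _ hk).1, (h _ hk).2.1, (h _ (by lia)).1, Nat.add_sub_cancel]
    calc σ ^ (j + 1) + σ ^ j = (σ + 1) * σ ^ j := by ring
      _ < σ ^ 2 * σ ^ j := by gcongr; nlinarith
      _ = σ ^ (j + 1 + 1) := by ring
  · refine (tendsto_pow_atTop_atTop_of_one_lt (by linarith : 1 < σ)).congr' ?_
    filter_upwards [eventually_ge_atTop 1] with k hk using ((h k hk).1).symm

theorem IsGeometric.le_count (h : IsGeometric σ q τ δ n) (hσ : 0 ≤ σ) {k : ℕ} (hk : 1 ≤ k) :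
    (σ ^ q) ^ k ≤ n k := by
  rw [(h k hk).2.2, ← Real.rpow_mul_natCast hσ]
  exact Nat.le_ceil _

theorem IsGeometric.count_le (h : IsGeometric σ q τ δ n) (hσ : 1 ≤ σ) (hq : 0 ≤ q) {k : ℕ}
    (hk : 1 ≤ k) : n k ≤ 2 * (σ ^ q) ^ k := by
  have hone : 1 ≤ (σ ^ q) ^ k := one_le_pow₀ (Real.one_le_rpow hσ hq)
  rw [(h k hk).2.2, Real.rpow_mul_natCast (zero_le_one.trans hσ)]
  exact Nat.ceil_le_two_mul (by linarith)

theorem IsGeometric.rate_le (h : IsGeometric σ q τ δ n) (hσ : 1 ≤ σ) (hq : 0 ≤ q) {k : ℕ}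
    (hk : 1 ≤ k) : (n k : ℝ) / δ k ≤ 2 * σ * (τ k) ^ (q - 1) := by
  have hσ0 : 0 < σ := by linarith
  rw [(h k hk).1, (h k hk).2.1, div_le_iff₀ (by positivity)]
  calc (n k : ℝ) ≤ 2 * (σ ^ q) ^ k := h.count_le hσ hq hk
    _ = 2 * (σ ^ k) ^ q := by rw [← Real.rpow_pow_comm hσ0.le]
    _ = 2 * σ * (σ ^ k) ^ (q - 1) * σ ^ (k - 1) := by
      rw [Real.rpow_sub_one (by positivity), ← pow_sub_one_mul (by lia : k ≠ 0) σ]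
      field_simp

theorem IsGeometric.rate_pow_le (h : IsGeometric σ q τ δ n) (hσ : 2 ≤ σ) (hq : 0 ≤ q) {k : ℕ}
    (hk : 1 ≤ k) {t : ℝ} (ht : t ∈ Icc (τ k) (τ k + δ k)) (l : ℕ) :
    ((n k : ℝ) / δ k) ^ l ≤
      (2 * σ) ^ l * 3 ^ |(q - 1) * l| * (1 + t) ^ (-((1 - q) * (l : ℝ))) := by
  have had := h.isAdmissible hσ
  have hτ : 1 ≤ τ k := by
    rw [(h k hk).1]
    exact one_le_pow₀ (by linarith)
  have hδτ : δ k ≤ τ k := by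
    rw [(h k hk).1, (h k hk).2.1]
    exact pow_le_pow_right₀ (by linarith) (Nat.sub_le k 1)
  calc ((n k : ℝ) / δ k) ^ l ≤ (2 * σ * (τ k) ^ (q - 1)) ^ l :=
        pow_le_pow_left₀ (had.rate_pos hk).le (h.rate_le (by linarith) hq hk) l
    _ = (2 * σ) ^ l * (τ k) ^ ((q - 1) * l) := by
      rw [mul_pow, Real.rpow_mul_natCast (by linarith)]
    _ ≤ (2 * σ) ^ l * (3 ^ |(q - 1) * l| * (1 + t) ^ ((q - 1) * l)) :=
      mul_le_mul_of_nonneg_left (rpow_le_three_rpow_abs_mul (by linarith) (by linarith [ht.1])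
        (by linarith [ht.2]) _) (by positivity)
    _ = _ := by rw [← mul_assoc, ← neg_mul, neg_sub]

theorem IsGeometric.exists_abs_iteratedDeriv_coefficient_le (h : IsGeometric σ q τ δ n)
    (hσ : 2 ≤ σ) (hq : 0 ≤ q) {φ : ℝ → ℝ} (hφ : IsProfile φ) (l : ℕ) :
    ∃ C : ℝ, ∀ t : ℝ, 0 ≤ t →
      |iteratedDeriv l (coefficient φ τ δ n) t| ≤ C * (1 + t) ^ (-((1 - q) * (l : ℝ))) := by
  have had := h.isAdmissible hσ
  rcases Nat.eq_zero_or_pos l with rfl | hl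
  · obtain ⟨m, hm, hbounds⟩ := had.exists_coefficient_bounds hφ
    refine ⟨2, fun t _ => ?_⟩
    simp only [iteratedDeriv_zero, Nat.cast_zero, mul_zero, neg_zero, Real.rpow_zero, mul_one]
    exact abs_le.2 ⟨by linarith [(hbounds t).1], (hbounds t).2.le⟩
  obtain ⟨C, hC0, hC⟩ := hφ.exists_iteratedDeriv_bound l
  refine ⟨(2 * σ) ^ l * 3 ^ |(q - 1) * l| * C, fun t ht => ?_⟩
  by_cases hmem : ∃ k, 1 ≤ k ∧ t ∈ Icc (τ k) (τ k + δ k)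
  · obtain ⟨k, hk, hkt⟩ := hmem
    rw [had.iteratedDeriv_coefficient_of_mem hφ hk hl hkt, hφ.iteratedDeriv_periodisation, abs_mul,
      abs_of_nonneg (pow_nonneg (had.rate_pos hk).le l), mul_right_comm]
    exact mul_le_mul (h.rate_pow_le hσ hq hk hkt l) (hC _) (abs_nonneg _) (by positivity)
  · rw [had.iteratedDeriv_coefficient_of_notMem hl fun k hk hkt => hmem ⟨k, hk, hkt⟩, abs_zero]
    positivity

theorem IsGeometric.mul_rpow_pow_le_growth_exponent (h : IsGeometric σ q τ δ n) (hσ : 1 < σ)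
    (hq : 0 < q) {κ c : ℝ} (hκ : 0 < κ) (hc : 0 ≤ c) (hσκ : 1 + 4 * c / κ ≤ σ ^ q) {k : ℕ}
    (hk : 1 ≤ k) :
    κ * (σ ^ q) ^ k ≤ 2 * κ * n k - 2 * c * ∑ l ∈ Finset.Ico 1 k, (n l : ℝ) := by
  have hlower := h.le_count (by linarith) hk
  have hsum : ∑ l ∈ Finset.Ico 1 k, (n l : ℝ) ≤ 2 * ∑ l ∈ Finset.range k, (σ ^ q) ^ l := by
    rw [Finset.mul_sum, Finset.range_eq_Ico]
    exact (Finset.sum_le_sum fun l hl => h.count_le hσ.le hq.le (Finset.mem_Ico.1 hl).1).trans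
      (Finset.sum_le_sum_of_subset_of_nonneg (Finset.Ico_subset_Ico_left zero_le_one)
        fun l _ _ => by positivity)
  have hratio : 4 * c ≤ κ * (σ ^ q - 1) := (div_le_iff₀' hκ).1 (by linarith)
  have hgeom : 2 * c * (2 * ∑ l ∈ Finset.range k, (σ ^ q) ^ l) ≤ κ * (σ ^ q) ^ k := by
    calc 2 * c * (2 * ∑ l ∈ Finset.range k, (σ ^ q) ^ l)
        = 4 * c * ∑ l ∈ Finset.range k, (σ ^ q) ^ l := by ring
      _ ≤ κ * (σ ^ q - 1) * ∑ l ∈ Finset.range k, (σ ^ q) ^ l := by gcongr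
      _ = κ * ((σ ^ q) ^ k - 1) := by rw [mul_assoc, mul_geom_sum]
      _ ≤ κ * (σ ^ q) ^ k := by gcongr; linarith
  calc κ * (σ ^ q) ^ k = 2 * κ * (σ ^ q) ^ k - κ * (σ ^ q) ^ k := by ring
    _ ≤ 2 * κ * n k - 2 * c * (2 * ∑ l ∈ Finset.range k, (σ ^ q) ^ l) := by gcongr
    _ ≤ _ := by gcongr

theorem IsGeometric.tendsto_growth_exponent (h : IsGeometric σ q τ δ n) (hσ : 1 < σ) (hq : 0 < q)
    {κ c : ℝ} (hκ : 0 < κ) (hc : 0 ≤ c) (hσκ : 1 + 4 * c / κ ≤ σ ^ q) :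
    Tendsto (fun k => 2 * κ * n k - 2 * c * ∑ l ∈ Finset.Ico 1 k, (n l : ℝ)) atTop atTop := by
  refine tendsto_atTop_mono' _ ?_ ((tendsto_pow_atTop_atTop_of_one_lt
    (Real.one_lt_rpow hσ hq)).const_mul_atTop hκ)
  filter_upwards [eventually_ge_atTop 1] with k hk
  exact h.mul_rpow_pow_le_growth_exponent hσ hq hκ hc hσκ hk

end Geometric

theorem mainTheorem10 (d : ℕ) (hd : 1 ≤ d) (φ : ℝ → ℝ) (hφ : IsProfile φ) :
    -- the lower energy bound, with constants depending only on the oscillation profile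
    (∃ κ c : ℝ, 0 < κ ∧ 0 < c ∧
      IsLUB (Set.range fun s : ℝ => |deriv (periodisation φ) s| / (1 + periodisation φ s)) c ∧
      ∀ (τ δ : ℕ → ℝ) (n : ℕ → ℕ), IsAdmissible τ δ n →
        ∃ u₀ u₁ : ℕ → 𝓢(Space d, ℂ), ∀ k, 1 ≤ k →
          energy (u₀ k) (u₁ k) = 1 ∧
          (∃ u v, IsWaveSolution (coefficient φ τ δ n) (u₀ k) (u₁ k) u v) ∧
          ∀ u v, IsWaveSolution (coefficient φ τ δ n) (u₀ k) (u₁ k) u v →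
            0 < energy (u (τ k + δ k)) (v (τ k + δ k)) ∧
            Real.log (energy (u (τ k + δ k)) (v (τ k + δ k))) ≥
              2 * κ * (n k : ℝ) - 2 * c * ∑ l ∈ Finset.Ico 1 k, (n l : ℝ)) ∧
    -- the failure of uniform energy bounds in the weaker coefficient classes
    (∀ q : ℝ, 0 < q → ∃ σ₀ : ℝ, 1 < σ₀ ∧ ∀ σ : ℝ, σ₀ ≤ σ →
      ∀ (τ δ : ℕ → ℝ) (n : ℕ → ℕ),
        (∀ k, 1 ≤ k → τ k = σ ^ k ∧ δ k = σ ^ (k - 1) ∧ n k = ⌈σ ^ (q * (k : ℝ))⌉₊) →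
        IsAdmissible τ δ n ∧
        ContDiff ℝ ∞ (coefficient φ τ δ n) ∧
        (∃ m : ℝ, 0 < m ∧ ∀ t, m ≤ coefficient φ τ δ n t ∧ coefficient φ τ δ n t < 2) ∧
        (∀ l : ℕ, ∃ C : ℝ, ∀ t : ℝ, 0 ≤ t →
          |iteratedDeriv l (coefficient φ τ δ n) t| ≤ C * (1 + t) ^ (-((1 - q) * (l : ℝ)))) ∧
        ¬ ∃ C : ℝ, ∀ (u₀ u₁ : 𝓢(Space d, ℂ)) (u v : ℝ → 𝓢(Space d, ℂ)),
          IsWaveSolution (coefficient φ τ δ n) u₀ u₁ u v →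
            ∀ t : ℝ, 0 ≤ t → energy (u t) (v t) ≤ C * energy u₀ u₁) := by
  obtain ⟨c, hc, hlub⟩ := hφ.exists_isLUB_logDeriv
  obtain ⟨κ, hκ, hdata⟩ := hφ.exists_resonant_data hd
  have hlog : ∀ s, |deriv (periodisation φ) s| ≤ c * (1 + periodisation φ s) := fun s =>
    (div_le_iff₀ (neg_lt_iff_pos_add'.1 (abs_lt.1 (hφ.abs_lt_one _)).1)).1 (hlub.1 ⟨s, rfl⟩)
  refine ⟨⟨κ, c, hκ, hc, hlub, fun τ δ n h => ?_⟩, fun q hq => ?_⟩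
  · choose! u₀ u₁ hone hexists hgrow using hdata c hlog τ δ n h
    refine ⟨u₀, u₁, fun k hk => ⟨hone k hk, hexists k hk, fun u v huv => ?_⟩⟩
    have hpos := (Real.exp_pos _).trans_le (hgrow k hk u v huv)
    exact ⟨hpos, (Real.le_log_iff_exp_le hpos).2 (hgrow k hk u v huv)⟩
  · obtain ⟨σ₁, hσ₁⟩ := eventually_atTop.1
      ((tendsto_rpow_atTop hq).eventually_ge_atTop (1 + 4 * c / κ))
    refine ⟨max 2 σ₁, lt_max_of_lt_left one_lt_two, fun σ hσ τ δ n (hgeo : IsGeometric σ q τ δ n) =>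
      ?_⟩
    obtain ⟨hσ2, hσσ₁⟩ := max_le_iff.1 hσ
    have h := hgeo.isAdmissible hσ2
    exact ⟨h, h.contDiff_coefficient hφ, h.exists_coefficient_bounds hφ,
      hgeo.exists_abs_iteratedDeriv_coefficient_le hσ2 hq.le hφ,
      not_exists_energy_le_of_tendsto
        (hgeo.tendsto_growth_exponent (by linarith) hq hκ hc.le (hσ₁ σ hσσ₁))
        (fun k hk => add_nonneg (h.left_nonneg hk) (h.length_pos k hk).le) (hdata c hlog τ δ n h)⟩
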